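/- For a finite simple graph $G$ on $n$ vertices with degree matrix $D(G)$ and adjacency matrix $A(G)$, let $Q(G)=D(G)+A(G)$ be its signless Laplacian matrix and define the signless Laplacian coefficients $\varphi_0(G),\dots,\varphi_n(G)$ by $$\det(xI-Q(G))=\sum_{i=0}^{n}(-1)^i\varphi_i(G)\,x^{n-i}.$$ Let $n\ge 6$ and let $G$ be an $n$-vertex unicyclic graph (a connected graph with $n$ edges) whose unique cycle has length $g\ge 5$. A pendent path of length $k\ge1$ attached to a vertex $a$ is a path $a v_1\cdots v_k$ with $d(a)\ge 3$, $d(v_1)=\dots=d(v_{k-1})=2$ and $d(v_k)=1$. Assume that only pendent paths of length at most $2$ are attached to the cycle of $G$, that is, every vertex not on the cycle lies on a pendent path of length at most $2$ attached to a vertex of the cycle. Let $u,v,w$ be distinct vertices of the cycle with $u\sim v$ and $v\sim w$, write $$N_G(v)=\{u,w,v_1,v_2,\dots\},\qquad N_G(w)=\{v,w_1,w_2,\dots\},$$ and let $$G'=G-\{ww_1,ww_2,\dots,vv_1,vv_2,\dots\}+\{uw_1,uw_2,\dots,uv_1,uv_2,\dots\}.$$ Then $$\varphi_i(G)\ \ge\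 \varphi_i(G')\qquad\text{for all } i=0,1,\dots,n,$$ and equality holds if and only if $i\in\{0,1,n\}$, or $n=6$, $g=5$ and $i=5$. -/

import Mathlib

namespace SimpleGraph

/-- A unicyclic graph: connected, with as many edges as vertices. -/
def IsUnicyclic {V : Type*} [Fintype V] (G : SimpleGraph V) : Prop :=
  G.Connected ∧ G.edgeSet.ncard = Fintype.card V

/-- The vertex `x` lies on a cycle of `G`. For a unicyclic graph this says that
`x` is a vertex of its unique cycle. -/
def OnCycle {V : Type*} (G : SimpleGraph V) (x : V) : Prop :=
  ∃ c : G.Walk x x, c.IsCycle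

open Classical in
/-- The walk `p = a v₁ v₂ ⋯ v_k` is a pendent path of length `k ≥ 1` attached to `a`:
a path with `d(v₁) = ⋯ = d(v_{k-1}) = 2`, `d(v_k) = 1` and `d(a) ≥ 3`. -/
def IsPendentPath {V : Type*} [Fintype V] (G : SimpleGraph V) {a b : V}
    (p : G.Walk a b) : Prop :=
  p.IsPath ∧ 1 ≤ p.length ∧ 3 ≤ G.degree a ∧ G.degree b = 1 ∧
    ∀ j, 0 < j → j < p.length → G.degree (p.getVert j) = 2

/-- Only pendent paths of length at most `k` are attached to the cycle: every vertex off the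
cycle lies on a pendent path of length at most `k` attached to a vertex of the cycle. -/
def OnlyPendentPathsOnCycle {V : Type*} [Fintype V] (G : SimpleGraph V) (k : ℕ) : Prop :=
  ∀ x, ¬ G.OnCycle x → ∃ (a b : V) (p : G.Walk a b),
    G.OnCycle a ∧ G.IsPendentPath p ∧ p.length ≤ k ∧ x ∈ p.support

/-- For `N(v) = {u, w, v₁, v₂, …}` and `N(w) = {v, w₁, w₂, …}`, the graph
`G - {w w₁, w w₂, …, v v₁, v v₂, …} + {u w₁, u w₂, …, u v₁, u v₂, …}`. -/
def moveBranches {V : Type*} (G : SimpleGraph V) (u v w : V) : SimpleGraph V :=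
  G.deleteEdges
      ({e | ∃ x ∈ G.neighborSet w \ {v}, e = s(w, x)} ∪
        {e | ∃ x ∈ G.neighborSet v \ {u, w}, e = s(v, x)}) ⊔
    fromEdgeSet
      ({e | ∃ x ∈ G.neighborSet w \ {v}, e = s(u, x)} ∪
        {e | ∃ x ∈ G.neighborSet v \ {u, w}, e = s(u, x)})

open Classical in
/-- The signless Laplacian matrix `Q(G) = D(G) + A(G)`. -/
noncomputable def signlessLapMatrix {V : Type*} [Fintype V] (G : SimpleGraph V) :
    Matrix V V ℝ :=
  G.degMatrix ℝ + G.adjMatrix ℝ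

open Classical in
/-- The signless Laplacian coefficient `φ_i(G)`, for `0 ≤ i ≤ n`, where
`det (x I - Q(G)) = ∑ i, (-1) ^ i * φ_i(G) * x ^ (n - i)`. -/
noncomputable def signlessLapCoeff {V : Type*} [Fintype V] (G : SimpleGraph V) (i : ℕ) : ℝ :=
  (-1) ^ i * G.signlessLapMatrix.charpoly.coeff (Fintype.card V - i)

end SimpleGraph

section Prelim

open Polynomial Finset

namespace Polynomial

/-- All coefficients are nonnegative, and they vanish outside of the degrees `a, …, b`. -/
def NonnegOn (a b : ℕ) (f : ℝ[X]) : Prop :=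
  ∀ k, 0 ≤ f.coeff k ∧ (f.coeff k ≠ 0 → a ≤ k ∧ k ≤ b)

/-- The coefficients in the degrees `a, …, b` are positive, and all the others vanish. -/
def PosOn (a b : ℕ) (f : ℝ[X]) : Prop :=
  ∀ k, ((a ≤ k ∧ k ≤ b) → 0 < f.coeff k) ∧ (¬ (a ≤ k ∧ k ≤ b) → f.coeff k = 0)

theorem PosOn.nonnegOn {a b : ℕ} {f : ℝ[X]} (h : PosOn a b f) : NonnegOn a b f := by
  intro k
  by_cases hk : a ≤ k ∧ k ≤ b
  · exact ⟨((h k).1 hk).le, fun _ => hk⟩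
  · exact ⟨((h k).2 hk).ge, fun h' => absurd ((h k).2 hk) h'⟩

theorem NonnegOn.mono {a b c d : ℕ} {f : ℝ[X]} (h : NonnegOn a b f) (hca : c ≤ a) (hbd : b ≤ d) :
    NonnegOn c d f :=
  fun k => ⟨(h k).1, fun hk => ⟨hca.trans ((h k).2 hk).1, ((h k).2 hk).2.trans hbd⟩⟩

theorem NonnegOn.add {a b : ℕ} {f g : ℝ[X]} (hf : NonnegOn a b f) (hg : NonnegOn a b g) :
    NonnegOn a b (f + g) := by
  intro k
  rw [coeff_add]
  refine ⟨add_nonneg (hf k).1 (hg k).1, fun h => ?_⟩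
  by_cases h0 : f.coeff k = 0
  · exact (hg k).2 (by rwa [h0, zero_add] at h)
  · exact (hf k).2 h0

theorem NonnegOn.mul {a b c d : ℕ} {f g : ℝ[X]} (hf : NonnegOn a b f) (hg : NonnegOn c d g) :
    NonnegOn (a + c) (b + d) (f * g) := by
  intro k
  rw [coeff_mul]
  refine ⟨sum_nonneg fun x _ => mul_nonneg (hf _).1 (hg _).1, fun h => ?_⟩
  obtain ⟨x, hx, hx0⟩ := exists_ne_zero_of_sum_ne_zero h
  have h1 := (hf _).2 (left_ne_zero_of_mul hx0)
  have h2 := (hg _).2 (right_ne_zero_of_mul hx0)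
  have := HasAntidiagonal.mem_antidiagonal.1 hx
  omega

theorem nonnegOn_zero (a b : ℕ) : NonnegOn a b 0 := fun k => by simp

theorem PosOn.add_nonnegOn {a b : ℕ} {f g : ℝ[X]} (hf : PosOn a b f) (hg : NonnegOn a b g) :
    PosOn a b (f + g) := by
  intro k
  rw [coeff_add]
  refine ⟨fun h => add_pos_of_pos_of_nonneg ((hf k).1 h) (hg k).1, fun h => ?_⟩
  rw [(hf k).2 h, zero_add]
  by_contra h0
  exact h ((hg k).2 h0)

theorem PosOn.add_posOn {a b c d : ℕ} {f g : ℝ[X]} (hf : PosOn a b f) (hg : PosOn c d g)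
    (hac : a ≤ c) (hcb : c ≤ b + 1) (hbd : b ≤ d) : PosOn a d (f + g) := by
  intro k
  rw [coeff_add]
  refine ⟨fun h => ?_, fun h => ?_⟩
  · by_cases hk : k ≤ b
    · exact add_pos_of_pos_of_nonneg ((hf k).1 ⟨h.1, hk⟩) (hg.nonnegOn k).1
    · exact add_pos_of_nonneg_of_pos (hf.nonnegOn k).1 ((hg k).1 ⟨by omega, h.2⟩)
  · rw [(hf k).2 (by omega), (hg k).2 (by omega), zero_add]

theorem PosOn.mul {a b c d : ℕ} {f g : ℝ[X]} (hf : PosOn a b f) (hg : PosOn c d g)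
    (hab : a ≤ b) (hcd : c ≤ d) : PosOn (a + c) (b + d) (f * g) := by
  intro k
  refine ⟨fun h => ?_, fun h => ?_⟩
  · rw [coeff_mul]
    refine sum_pos' (fun x _ => mul_nonneg (hf.nonnegOn _).1 (hg.nonnegOn _).1)
      ⟨(max a (k - d), k - max a (k - d)), ?_, mul_pos ((hf _).1 ?_) ((hg _).1 ?_)⟩
    · rw [HasAntidiagonal.mem_antidiagonal]; simp only; omega
    · simp only; omega
    · simp only; omega
  · by_contra h0
    exact h (((hf.nonnegOn.mul hg.nonnegOn) k).2 h0)

theorem posOn_one : PosOn 0 0 (1 : ℝ[X]) := by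
  intro k
  rw [coeff_one]
  split_ifs with h <;> constructor <;> intro h' <;> simp at * <;> omega

theorem posOn_X_pow (n : ℕ) : PosOn n n (X ^ n : ℝ[X]) := by
  intro k
  rw [coeff_X_pow]
  split_ifs with h <;> constructor <;> intro h' <;> simp at * <;> omega

theorem posOn_X : PosOn 1 1 (X : ℝ[X]) := by simpa using posOn_X_pow 1

theorem PosOn.C_mul {a b : ℕ} {f : ℝ[X]} (hf : PosOn a b f) {r : ℝ} (hr : 0 < r) :
    PosOn a b (C r * f) := by
  intro k
  rw [coeff_C_mul]
  exact ⟨fun h => mul_pos hr ((hf k).1 h), fun h => by rw [(hf k).2 h, mul_zero]⟩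

theorem PosOn.natCast_mul {a b : ℕ} {f : ℝ[X]} (hf : PosOn a b f) {n : ℕ} (hn : 0 < n) :
    PosOn a b ((n : ℝ[X]) * f) := by
  simpa using hf.C_mul (r := n) (by exact_mod_cast hn)

/-- Horner step: prepend a positive constant coefficient. -/
theorem PosOn.C_add_X_mul {b : ℕ} {f : ℝ[X]} (hf : PosOn 0 b f) {r : ℝ} (hr : 0 < r) :
    PosOn 0 (b + 1) (C r + X * f) := by
  have h1 : PosOn 0 0 (C r : ℝ[X]) := by simpa using posOn_one.C_mul hr
  have h2 := posOn_X.mul hf le_rfl (Nat.zero_le b)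
  exact h1.add_posOn (by simpa [add_comm] using h2) (by omega) (by omega) (by omega)

theorem posOn_C {r : ℝ} (hr : 0 < r) : PosOn 0 0 (C r : ℝ[X]) := by
  simpa using posOn_one.C_mul hr

theorem posOn_one_add_X : PosOn 0 1 (1 + X : ℝ[X]) := by
  simpa using (posOn_C one_pos).C_add_X_mul one_pos

theorem posOn_one_add_two_X : PosOn 0 1 (1 + 2 * X : ℝ[X]) := by
  convert (posOn_C (r := 2) two_pos).C_add_X_mul one_pos using 1
  simp only [map_one, map_ofNat]; ring

theorem posOn_one_add_three_X : PosOn 0 1 (1 + 3 * X : ℝ[X]) := by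
  convert (posOn_C (r := 3) three_pos).C_add_X_mul one_pos using 1
  simp only [map_one, map_ofNat]; ring

theorem posOn_quadratic : PosOn 0 2 (1 + 3 * X + X ^ 2 : ℝ[X]) := by
  convert ((posOn_C one_pos).C_add_X_mul (r := 3) three_pos).C_add_X_mul one_pos using 1
  simp only [map_one, map_ofNat]; ring

theorem PosOn.pow {b : ℕ} {f : ℝ[X]} (hf : PosOn 0 b f) (n : ℕ) : PosOn 0 (n * b) (f ^ n) := by
  induction n with
  | zero => simpa using posOn_one
  | succ n ih =>
    rw [pow_succ, Nat.succ_mul]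
    simpa using ih.mul hf (Nat.zero_le _) (Nat.zero_le _)

/-- `det (1 + X Q)` for the principal block of the signless Laplacian on the vertices of `a`
pendent paths of length one and `b` pendent paths of length two attached to one vertex. -/
noncomputable def branchPoly (a b : ℕ) : ℝ[X] := (1 + X) ^ a * (1 + 3 * X + X ^ 2) ^ b

/-- `branchPoly a b` times the contribution `a X / (1 + X) + b X (1 + 2 X) / (1 + 3 X + X ^ 2)`
of the pendent paths to the pivot of the vertex they are attached to. -/
noncomputable def branchNum (a b : ℕ) : ℝ[X] :=
  ((a : ℝ[X]) * (1 + X) ^ (a - 1)) * (1 + 3 * X + X ^ 2) ^ b * X +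
    (1 + X) ^ a * ((b : ℝ[X]) * (1 + 3 * X + X ^ 2) ^ (b - 1)) * (X * (1 + 2 * X))

theorem posOn_branchPoly (a b : ℕ) : PosOn 0 (a + 2 * b) (branchPoly a b) := by
  simpa [branchPoly, mul_comm] using
    (posOn_one_add_X.pow a).mul (posOn_quadratic.pow b) (Nat.zero_le _) (Nat.zero_le _)

theorem branchPoly_add (a b a' b' : ℕ) :
    branchPoly (a + a') (b + b') = branchPoly a b * branchPoly a' b' := by
  simp only [branchPoly, pow_add]; ring

theorem natCast_mul_pow_pred_add (y : ℝ[X]) (a a' : ℕ) :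
    ((a + a' : ℕ) : ℝ[X]) * y ^ (a + a' - 1) =
      a * y ^ (a - 1) * y ^ a' + y ^ a * (a' * y ^ (a' - 1)) := by
  rcases a with _ | a <;> rcases a' with _ | a'
  · simp
  · simp
  · simp
  · rw [show a + 1 + (a' + 1) - 1 = a + a' + 1 by omega]
    simp only [Nat.add_sub_cancel]
    push_cast
    ring

theorem branchNum_add (a b a' b' : ℕ) :
    branchNum (a + a') (b + b') =
      branchNum a b * branchPoly a' b' + branchPoly a b * branchNum a' b' := by
  simp only [branchNum, branchPoly, natCast_mul_pow_pred_add, pow_add]; ring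

theorem branchPoly_zero : branchPoly 0 0 = 1 := by simp [branchPoly]
theorem branchNum_zero : branchNum 0 0 = 0 := by simp [branchNum]
theorem branchPoly_one_zero : branchPoly 1 0 = 1 + X := by simp [branchPoly]
theorem branchNum_one_zero : branchNum 1 0 = X := by simp [branchNum]
theorem branchPoly_zero_one : branchPoly 0 1 = 1 + 3 * X + X ^ 2 := by simp [branchPoly]
theorem branchNum_zero_one : branchNum 0 1 = X * (1 + 2 * X) := by simp [branchNum]

theorem branchNum_succ_left (a b : ℕ) :
    branchNum (a + 1) b = branchNum a b * (1 + X) + branchPoly a b * X := by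
  simpa [branchPoly_one_zero, branchNum_one_zero] using branchNum_add a b 1 0

theorem branchNum_succ_right (a b : ℕ) :
    branchNum a (b + 1) =
      branchNum a b * (1 + 3 * X + X ^ 2) + branchPoly a b * (X * (1 + 2 * X)) := by
  simpa [branchPoly_zero_one, branchNum_zero_one] using branchNum_add a b 0 1

theorem branchPoly_succ_left (a b : ℕ) : branchPoly (a + 1) b = branchPoly a b * (1 + X) := by
  simpa [branchPoly_one_zero] using branchPoly_add a b 1 0

theorem branchPoly_succ_right (a b : ℕ) :
    branchPoly a (b + 1) = branchPoly a b * (1 + 3 * X + X ^ 2) := by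
  simpa [branchPoly_zero_one] using branchPoly_add a b 0 1

theorem nonnegOn_branchNum (a b : ℕ) : NonnegOn 1 (a + 2 * b) (branchNum a b) := by
  induction a with
  | zero =>
    induction b with
    | zero => simpa [branchNum_zero] using nonnegOn_zero 1 0
    | succ b ih =>
      rw [branchNum_succ_right]
      refine ((ih.mul posOn_quadratic.nonnegOn).mono (by omega) (by omega)).add
        (((posOn_branchPoly 0 b).nonnegOn.mul
          (posOn_X.nonnegOn.mul posOn_one_add_two_X.nonnegOn)).mono (by omega) (by omega))
  | succ a ih =>
    rw [branchNum_succ_left]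
    exact ((ih.mul posOn_one_add_X.nonnegOn).mono (by omega) (by omega)).add
      (((posOn_branchPoly a b).nonnegOn.mul posOn_X.nonnegOn).mono (by omega) (by omega))

theorem posOn_branchNum {a b : ℕ} (h : 0 < a + b) : PosOn 1 (a + 2 * b) (branchNum a b) := by
  rcases a with _ | a
  · obtain ⟨b, rfl⟩ : ∃ c, b = c + 1 := ⟨b - 1, by omega⟩
    rw [branchNum_succ_right, add_comm (branchNum _ _ * _)]
    have h1 := (posOn_branchPoly 0 b).mul (posOn_X.mul posOn_one_add_two_X (by omega) (by omega))
      (by omega) (by omega)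
    rw [show 0 + 2 * b + (1 + 1) = 0 + 2 * (b + 1) by omega] at h1
    exact h1.add_nonnegOn
      (((nonnegOn_branchNum 0 b).mul posOn_quadratic.nonnegOn).mono (by omega) (by omega))
  · rw [branchNum_succ_left, add_comm (branchNum _ _ * _)]
    have h1 := (posOn_branchPoly a b).mul posOn_X (by omega) (by omega)
    rw [show a + 2 * b + 1 = a + 1 + 2 * b by omega] at h1
    exact h1.add_nonnegOn
      (((nonnegOn_branchNum a b).mul posOn_one_add_X.nonnegOn).mono (by omega) (by omega))

end Polynomial

/-- The row vector `(x, y)` times the transfer matrices `((1 + t) p i + H i, t p i; p i + H i, t p i)`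
of the first `j` vertices of a path. -/
def transfer {R : Type*} [CommRing R] (t : R) (p H : ℕ → R) (x y : R) : ℕ → R × R
  | 0 => (x, y)
  | j + 1 =>
    ((transfer t p H x y j).1 * ((1 + t) * p j + H j) + (transfer t p H x y j).2 * (p j + H j),
      t * p j * ((transfer t p H x y j).1 + (transfer t p H x y j).2))

section Transfer

variable {R : Type*} [CommRing R] (t : R) (p H : ℕ → R)

theorem transfer_lin (c d x y x' y' : R) (j : ℕ) :
    transfer t p H (c * x + d * x') (c * y + d * y') j =
      (c * (transfer t p H x y j).1 + d * (transfer t p H x' y' j).1,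
        c * (transfer t p H x y j).2 + d * (transfer t p H x' y' j).2) := by
  induction j with
  | zero => rfl
  | succ j ih => simp only [transfer, ih]; ext <;> simp only <;> ring

theorem transfer_det (j : ℕ) :
    (transfer t p H 1 0 j).1 * (transfer t p H 0 1 j).2 -
      (transfer t p H 1 0 j).2 * (transfer t p H 0 1 j).1 =
        (t ^ j * ∏ i ∈ range j, p i) ^ 2 := by
  induction j with
  | zero => simp [transfer]
  | succ j ih =>
    simp only [transfer, prod_range_succ, pow_succ t]
    linear_combination (t ^ 2 * p j ^ 2) * ih

theorem transfer_map {S : Type*} [CommRing S] (φ : R →+* S) (x y : R) (j : ℕ) :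
    transfer (φ t) (fun i => φ (p i)) (fun i => φ (H i)) (φ x) (φ y) j =
      (φ (transfer t p H x y j).1, φ (transfer t p H x y j).2) := by
  induction j with
  | zero => rfl
  | succ j ih => simp only [transfer, ih, map_add, map_mul, map_one]

theorem transfer_homogeneous (h : ℕ → R) (x y : R) (j : ℕ) :
    transfer t p (fun i => p i * h i) x y j =
      ((∏ i ∈ range j, p i) * (transfer t 1 h x y j).1,
        (∏ i ∈ range j, p i) * (transfer t 1 h x y j).2) := by
  induction j with
  | zero => simp [transfer]
  | succ j ih =>
    simp only [transfer, ih, prod_range_succ, Pi.one_apply]; ext <;> simp only <;> ring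

/-- The difference `det (1 + t Q(G)) - det (1 + t Q(G'))` in terms of the branches: the indices
`0, …, m - 1` belong to the vertices of the cycle other than `u, v, w`, and `m, m + 1, m + 2` to
`u, v, w`. -/
def branchDiff (m : ℕ) : R :=
  let α := (transfer t p H 1 0 m).1
  let β := (transfer t p H 1 0 m).2
  let γ := (transfer t p H 0 1 m).1
  let δ := (transfer t p H 0 1 m).2
  let common := (α + β) * H m * H (m + 2) + t * H m * p (m + 2) * (γ + δ) +
    t * H (m + 2) * p m * α + t ^ 2 * p m * p (m + 2) * γ
  H (m + 1) * (common + (1 + t) * (α + β) * (H m * p (m + 2) + H (m + 2) * p m) +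
      t * p m * p (m + 2) * (t * α + (1 + t) * γ + ((1 + t) * δ - β))) +
    p (m + 1) * (1 + 2 * t) * common -
    2 * (-1) ^ m * (1 + 3 * t) * t ^ (m + 1) * (∏ i ∈ range (m + 3), p i)

theorem branchDiff_map {S : Type*} [CommRing S] (φ : R →+* S) (m : ℕ) :
    branchDiff (φ t) (fun i => φ (p i)) (fun i => φ (H i)) m = φ (branchDiff t p H m) := by
  have h1 := transfer_map t p H φ 1 0 m
  have h2 := transfer_map t p H φ 0 1 m
  rw [map_one, map_zero] at h1 h2
  simp only [branchDiff, h1, h2, map_add, map_sub, map_mul, map_pow, map_one, map_ofNat, map_neg,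
    map_prod]

end Transfer

namespace Polynomial

theorem NonnegOn.add' {a b c d : ℕ} {f g : ℝ[X]} (hf : NonnegOn a b f) (hg : NonnegOn c d g) :
    NonnegOn (min a c) (max b d) (f + g) :=
  (hf.mono (min_le_left _ _) (le_max_left _ _)).add (hg.mono (min_le_right _ _) (le_max_right _ _))

theorem NonnegOn.of_X_mul {b : ℕ} {f : ℝ[X]} (h : NonnegOn 0 b (X * f)) :
    NonnegOn 1 b (X * f) := by
  refine fun k => ⟨(h k).1, fun hk => ⟨?_, ((h k).2 hk).2⟩⟩
  rcases k with _ | k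
  · simp at hk
  · omega

theorem PosOn.prod {p : ℕ → ℝ[X]} {k : ℕ → ℕ} (hp : ∀ j, PosOn 0 (k j) (p j)) (j : ℕ) :
    PosOn 0 (∑ i ∈ range j, k i) (∏ i ∈ range j, p i) := by
  induction j with
  | zero => simpa using posOn_one
  | succ j ih =>
    rw [sum_range_succ, prod_range_succ]
    exact ih.mul (hp j) (Nat.zero_le _) (Nat.zero_le _)

section Transfer

variable {p H : ℕ → ℝ[X]} {k : ℕ → ℕ}

theorem nonnegOn_transfer (hp : ∀ j, NonnegOn 0 (k j) (p j)) (hH : ∀ j, NonnegOn 0 (k j) (H j))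
    {x y : ℝ[X]} {e e' j₀ : ℕ} (he : e ≤ e') (he' : e' ≤ e + 1)
    (hx : NonnegOn 0 (e + j₀ + ∑ i ∈ range j₀, k i) (transfer X p H x y j₀).1)
    (hy : NonnegOn 0 (e' + j₀ + ∑ i ∈ range j₀, k i) (transfer X p H x y j₀).2)
    {j : ℕ} (hj : j₀ ≤ j) :
    NonnegOn 0 (e + j + ∑ i ∈ range j, k i) (transfer X p H x y j).1 ∧
      NonnegOn 0 (e' + j + ∑ i ∈ range j, k i) (transfer X p H x y j).2 := by
  induction j, hj using Nat.le_induction with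
  | base => exact ⟨hx, hy⟩
  | succ j _ ih =>
    have h1 : NonnegOn 0 (1 + k j) ((1 + X) * p j + H j) :=
      ((posOn_one_add_X.nonnegOn.mul (hp j)).mono (by omega) (by omega)).add
        ((hH j).mono le_rfl (by omega))
    simp only [transfer, sum_range_succ]
    refine ⟨((ih.1.mul h1).mono (by omega) (by omega)).add
      ((ih.2.mul ((hp j).add (hH j))).mono (by omega) (by omega)), ?_⟩
    exact ((posOn_X.nonnegOn.mul (hp j)).mul (ih.1.add' ih.2)).mono (by omega) (by omega)

theorem nonnegOn_transfer_sub (hp : ∀ j, PosOn 0 (k j) (p j))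
    (hH : ∀ j, NonnegOn 0 (k j) (H j)) {x y : ℝ[X]} {e e' : ℕ} (he : e ≤ e') (he' : e' ≤ e + 1)
    (hx : NonnegOn 0 e x) (hy : NonnegOn 0 e' y) (j : ℕ) :
    NonnegOn 0 (e + j + ∑ i ∈ range j, k i)
        ((transfer X p H x y j).1 - (∏ i ∈ range j, p i) * (transfer X 1 0 x y j).1) ∧
      NonnegOn 0 (e' + j + ∑ i ∈ range j, k i)
        ((transfer X p H x y j).2 - (∏ i ∈ range j, p i) * (transfer X 1 0 x y j).2) := by
  induction j with
  | zero => simpa [transfer] using ⟨nonnegOn_zero _ _, nonnegOn_zero _ _⟩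
  | succ j ih =>
    have h1 : NonnegOn 0 (1 + k j) ((1 + X) * p j + H j) :=
      ((posOn_one_add_X.nonnegOn.mul (hp j).nonnegOn).mono (by omega) (by omega)).add
        ((hH j).mono le_rfl (by omega))
    have h0 := nonnegOn_transfer (p := 1) (H := 0) (k := 0) (x := x) (y := y) (j₀ := 0) (j := j)
      (fun _ => posOn_one.nonnegOn) (fun _ => nonnegOn_zero _ _) he he' (by simpa [transfer] using hx)
      (by simpa [transfer] using hy) (Nat.zero_le _)
    simp only [Pi.zero_apply, sum_const_zero, add_zero] at h0
    have hP := (PosOn.prod hp j).nonnegOn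
    simp only [transfer, sum_range_succ, prod_range_succ, Pi.one_apply, Pi.zero_apply]
    constructor
    · convert (((ih.1.mul h1).mono (by omega) (by omega)).add
        ((ih.2.mul ((hp j).nonnegOn.add (hH j))).mono (by omega) (by omega))).add
        (((hP.mul (hH j)).mul (h0.1.add' h0.2)).mono
          (c := 0) (d := e + (j + 1) + (∑ i ∈ range j, k i + k j)) (by omega) (by omega)) using 1
      ring
    · convert ((posOn_X.nonnegOn.mul (hp j).nonnegOn).mul (ih.1.add' ih.2)).mono
          (c := 0) (d := e' + (j + 1) + (∑ i ∈ range j, k i + k j)) (by omega) (by omega) using 1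
      ring

end Transfer

theorem transfer_one_zero (j : ℕ) :
    (PosOn 0 j (transfer (X : ℝ[X]) 1 0 0 1 (j + 1)).1 ∧
      (transfer (X : ℝ[X]) 1 0 0 1 (j + 1)).1.coeff j = j + 1) ∧
    PosOn 1 (j + 1) (transfer (X : ℝ[X]) 1 0 0 1 (j + 1)).2 ∧
      (transfer (X : ℝ[X]) 1 0 0 1 (j + 1)).2.coeff (j + 1) = 1 := by
  induction j with
  | zero => simpa [transfer] using ⟨posOn_one, posOn_X⟩
  | succ j ih =>
    obtain ⟨⟨h1, h2⟩, h3, h4⟩ := ih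
    rw [transfer]
    generalize (transfer (X : ℝ[X]) 1 0 0 1 (j + 1)).1 = f at *
    generalize (transfer (X : ℝ[X]) 1 0 0 1 (j + 1)).2 = g at *
    simp only [Pi.one_apply, Pi.zero_apply, mul_one, add_zero]
    have h1' : f.coeff (j + 1) = 0 := (h1 _).2 (by omega)
    refine ⟨⟨?_, ?_⟩, ?_, ?_⟩
    · have h := posOn_one_add_X.mul h1 (by omega) (by omega)
      rw [mul_comm f]
      exact (by simpa [add_comm] using h : PosOn 0 (j + 1) ((1 + X) * f)).add_posOn h3
        (by omega) (by omega) (by omega)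
    · rw [mul_add, mul_one, coeff_add, coeff_add, coeff_mul_X, h2, h4, h1']
      push_cast; ring
    · have h := posOn_X.mul ((h1.add_posOn h3 (by omega) (by omega) (by omega))) (by omega)
        (by omega)
      convert h using 1; omega
    · rw [coeff_X_mul, coeff_add, h1', h4, zero_add]

theorem posOn_transfer_one_zero_sub {m : ℕ} (hm : 3 ≤ m) :
    PosOn 0 m ((1 + 2 * X) * (transfer (X : ℝ[X]) 1 0 0 1 m).1 -
      2 * (-1) ^ m * (1 + 3 * X) * X ^ (m - 1)) := by
  obtain ⟨j, rfl⟩ : ∃ j, m = j + 1 := ⟨m - 1, by omega⟩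
  obtain ⟨⟨h1, h2⟩, -⟩ := transfer_one_zero j
  generalize (transfer (X : ℝ[X]) 1 0 0 1 (j + 1)).1 = f at *
  have h0 : PosOn 0 (j + 1) ((1 + 2 * X) * f) := by
    have := posOn_one_add_two_X.mul h1 (by omega) (by omega)
    simpa [add_comm] using this
  rw [Nat.add_sub_cancel]
  rcases Nat.even_or_odd (j + 1) with he | ho
  · have hj : (3 : ℝ) ≤ j := by
      rcases he with ⟨i, hi⟩
      exact_mod_cast (by omega : 3 ≤ j)
    rw [he.neg_one_pow]
    have key : ∀ i, ((1 + 2 * X) * f - 2 * 1 * (1 + 3 * X) * X ^ j).coeff i =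
        ((1 + 2 * X) * f).coeff i - (if i = j then 2 else 0) - (if i = j + 1 then 6 else 0) := by
      intro i
      rw [show (1 + 2 * X) * f - 2 * 1 * (1 + 3 * X) * X ^ j =
        (1 + 2 * X) * f - C 2 * X ^ j - C 6 * X ^ (j + 1) by
          simp only [map_ofNat]; ring, coeff_sub, coeff_sub, coeff_C_mul_X_pow, coeff_C_mul_X_pow]
    intro i
    rw [key]
    by_cases hi : i = j
    · subst hi
      refine ⟨fun _ => ?_, fun h => by omega⟩
      obtain ⟨l, rfl⟩ : ∃ l, i = l + 1 := ⟨i - 1, by rcases he with ⟨i, hi⟩; omega⟩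
      have h3 := (h1 l).1 ⟨by omega, by omega⟩
      have : ((1 + 2 * X) * f).coeff (l + 1) = f.coeff (l + 1) + 2 * f.coeff l := by
        rw [show (1 + 2 * X) * f = f + C 2 * (X * f) by simp only [map_ofNat]; ring, coeff_add,
          coeff_C_mul, coeff_X_mul]
      rw [this, h2]
      simp only [if_true, if_neg (show ¬ l + 1 = l + 1 + 1 by omega)]
      linarith
    · by_cases hi' : i = j + 1
      · subst hi'
        refine ⟨fun _ => ?_, fun h => by omega⟩
        have h3 : f.coeff (j + 1) = 0 := (h1 (j + 1)).2 (by omega)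
        have : ((1 + 2 * X) * f).coeff (j + 1) = f.coeff (j + 1) + 2 * f.coeff j := by
          rw [show (1 + 2 * X) * f = f + C 2 * (X * f) by simp only [map_ofNat]; ring, coeff_add,
            coeff_C_mul, coeff_X_mul]
        rw [this, h2, h3]
        simp only [if_true, if_neg (show ¬ j + 1 = j by omega)]
        linarith
      · simpa only [if_neg hi, if_neg hi', sub_zero] using h0 i
  · rw [ho.neg_one_pow]
    have h3 : PosOn j (j + 1) (2 * ((1 + 3 * X) * X ^ j) : ℝ[X]) := by
      have := (posOn_one_add_three_X.mul (posOn_X_pow j) (by omega) le_rfl).natCast_mul two_pos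
      simpa [add_comm] using this
    convert h0.add_nonnegOn (h3.nonnegOn.mono (Nat.zero_le _) le_rfl) using 1
    ring

end Polynomial

namespace Polynomial

theorem posOn_branchDiff_of_three_le {m : ℕ} (hm : 3 ≤ m) (A B : ℕ → ℕ) :
    PosOn 2 (m + 2 + ∑ j ∈ range (m + 3), (A j + 2 * B j))
      (branchDiff X (fun j => branchPoly (A j) (B j)) (fun j => branchNum (A j) (B j)) m) := by
  set p : ℕ → ℝ[X] := fun j => branchPoly (A j) (B j) with hpdef
  set H : ℕ → ℝ[X] := fun j => branchNum (A j) (B j) with hHdef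
  set k : ℕ → ℕ := fun j => A j + 2 * B j with hkdef
  have hp : ∀ j, PosOn 0 (k j) (p j) := fun j => posOn_branchPoly _ _
  have hH : ∀ j, NonnegOn 1 (k j) (H j) := fun j => nonnegOn_branchNum _ _
  have hp' : ∀ j, NonnegOn 0 (k j) (p j) := fun j => (hp j).nonnegOn
  have hH' : ∀ j, NonnegOn 0 (k j) (H j) := fun j => (hH j).mono (by omega) le_rfl
  have hα := nonnegOn_transfer hp' hH' (x := 1) (y := 0) (e := 0) (e' := 0) (j₀ := 0) (j := m)
    le_rfl (by omega) (by simpa [transfer] using posOn_one.nonnegOn)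
    (by simpa [transfer] using nonnegOn_zero 0 0) (Nat.zero_le _)
  have hlin := transfer_lin X p H X 0 0 1 0 0 m
  simp only [mul_zero, mul_one, add_zero, zero_mul] at hlin
  have hlin0 := transfer_lin X (1 : ℕ → ℝ[X]) 0 X 0 0 1 0 0 m
  simp only [mul_zero, mul_one, add_zero, zero_mul] at hlin0
  have hγ := nonnegOn_transfer hp' hH' (x := 0) (y := X) (e := 0) (e' := 1) (j₀ := 0) (j := m)
    (by omega) (by omega) (by simpa [transfer] using nonnegOn_zero 0 0)
    (by simpa [transfer] using posOn_X.nonnegOn.mono (Nat.zero_le _) le_rfl) (Nat.zero_le _)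
  rw [hlin] at hγ
  have hδ := nonnegOn_transfer hp' hH' (x := 0) (y := 1) (e := 0) (e' := 0) (j₀ := 0) (j := m)
    le_rfl (by omega) (by simpa [transfer] using nonnegOn_zero 0 0)
    (by simpa [transfer] using posOn_one.nonnegOn) (Nat.zero_le _)
  have hsub := (nonnegOn_transfer_sub hp hH' (x := 0) (y := X) (e := 0) (e' := 1) (by omega)
    (by omega) (nonnegOn_zero 0 0) (posOn_X.nonnegOn.mono (Nat.zero_le _) le_rfl) m).1
  rw [hlin, hlin0] at hsub
  have hμ := (nonnegOn_transfer hp' hH' (x := -1) (y := 1 + X) (e := 0) (e' := 1) (j₀ := 1)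
    (j := m) (by omega) (by omega) (by
      simp only [transfer]
      convert (posOn_X.nonnegOn.mul (hH' 0)).mono (c := 0) (d := 0 + 1 + ∑ i ∈ range 1, k i)
        (by omega) (by simp) using 1
      ring) (by
      simp only [transfer]
      convert ((posOn_X_pow 2).nonnegOn.mul (hp' 0)).mono (c := 0)
        (d := 1 + 1 + ∑ i ∈ range 1, k i) (by omega) (by simp) using 1
      ring) (by omega)).2
  have hlin' := transfer_lin X p H (1 + X) (-1) 0 1 1 0 m
  rw [show (1 + X) * 0 + -1 * 1 = (-1 : ℝ[X]) by ring,
    show (1 + X) * 1 + -1 * 0 = (1 + X : ℝ[X]) by ring] at hlin'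
  rw [hlin'] at hμ
  have hbr := posOn_transfer_one_zero_sub hm
  have hR := PosOn.prod hp m
  have hsum : ∑ j ∈ range (m + 3), k j = ∑ j ∈ range m, k j + k m + k (m + 1) + k (m + 2) := by
    rw [sum_range_succ, sum_range_succ, sum_range_succ]
  have hprod : ∏ j ∈ range (m + 3), p j = (∏ j ∈ range m, p j) * p m * p (m + 1) * p (m + 2) := by
    rw [prod_range_succ, prod_range_succ, prod_range_succ]
  have hpow : (X : ℝ[X]) ^ (m + 1) = X ^ 2 * X ^ (m - 1) := by rw [← pow_add]; congr 1; omega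
  rw [branchDiff, hprod, hsum, hpow]
  simp only at hα hγ hδ hsub hμ ⊢
  generalize (transfer X p H 1 0 m).1 = α at *
  generalize (transfer X p H 1 0 m).2 = β at *
  generalize (transfer X p H 0 1 m).1 = γ at *
  generalize (transfer X p H 0 1 m).2 = δ at *
  generalize (transfer (X : ℝ[X]) 1 0 0 1 m).1 = γ₀ at *
  generalize (∏ j ∈ range m, p j) = P at *
  generalize (∑ j ∈ range m, k j) = s at *
  have hγ' : NonnegOn 1 (m + s) (X * γ) := (hγ.1.mono le_rfl (by omega)).of_X_mul
  have hsub' : NonnegOn 1 (m + s) (X * (γ - P * γ₀)) :=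
    NonnegOn.of_X_mul (by convert hsub using 1 <;> [omega; ring])
  have hK := hα.1.add hα.2
  have hHu := hH m
  have hHv := hH (m + 1)
  have hHw := hH (m + 2)
  have hpu := hp' m
  have hpv := hp' (m + 1)
  have hpw := hp' (m + 2)
  have hs := posOn_one_add_two_X.nonnegOn
  have hX := posOn_X.nonnegOn
  have h1X := posOn_one_add_X.nonnegOn
  have hμ' : NonnegOn 0 (1 + m + s) ((1 + X) * δ - β) := by convert hμ using 1; ring
  have base : NonnegOn 2 (m + 1 + s + k m + k (m + 2)) ((α + β) * H m * H (m + 2) +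
      X * H m * p (m + 2) * (γ + δ) + X * H (m + 2) * p m * α) := by
    refine ((((hK.mul hHu).mul hHw).mono (by omega) (by omega)).add ?_).add
      ((((hX.mul hHw).mul hpu).mul hα.1).mono (by omega) (by omega))
    rw [show X * H m * p (m + 2) * (γ + δ) =
      H m * p (m + 2) * (X * γ) + X * H m * p (m + 2) * δ by ring]
    exact (((hHu.mul hpw).mul hγ').mono (by omega) (by omega)).add
      ((((hX.mul hHu).mul hpw).mul hδ.2).mono (by omega) (by omega))
  have common := base.add
    ((((hX.mul hpu).mul hpw).mul hγ').mono (c := 2) (d := m + 1 + s + k m + k (m + 2))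
      (by omega) (by omega))
  have inner : NonnegOn 1 (m + 2 + s + k m + k (m + 2))
      ((α + β) * H m * H (m + 2) + X * H m * p (m + 2) * (γ + δ) + X * H (m + 2) * p m * α +
        X * p m * p (m + 2) * (X * γ) + (1 + X) * (α + β) * (H m * p (m + 2) + H (m + 2) * p m) +
        X * p m * p (m + 2) * (X * α + ((1 + X) * δ - β)) +
        (1 + X) * p m * p (m + 2) * (X * γ)) := by
    refine (((common.mono (by omega) (by omega)).add ?_).add ?_).add ?_
    · exact ((h1X.mul hK).mul ((hHu.mul hpw).add' (hHw.mul hpu))).mono (by omega) (by omega)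
    · exact (((hX.mul hpu).mul hpw).mul ((hX.mul hα.1).add' hμ')).mono (by omega) (by omega)
    · exact (((h1X.mul hpu).mul hpw).mul hγ').mono (by omega) (by omega)
  have rest := ((hHv.mul inner).mono (c := 2)
    (d := m + 2 + (s + k m + k (m + 1) + k (m + 2))) (by omega) (by omega)).add
    (((hpv.mul hs).mul (base.add ((((hX.mul hpu).mul hpw).mul hsub').mono
      (c := 2) (d := m + 1 + s + k m + k (m + 2)) (by omega) (by omega)))).mono (c := 2)
    (d := m + 2 + (s + k m + k (m + 1) + k (m + 2))) (by omega) (by omega))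
  have main := ((posOn_X_pow 2).mul (((hR.mul (hp m) (by omega) (by omega)).mul (hp (m + 1))
    (by omega) (by omega)).mul (hp (m + 2)) (by omega) (by omega)) (by omega) (by omega)).mul hbr
    (by omega) (by omega)
  have := main.add_nonnegOn (rest.mono (by omega) (by omega))
  rw [show m + 2 + (s + k m + k (m + 1) + k (m + 2)) =
    2 + (0 + s + k m + k (m + 1) + k (m + 2)) + m by ring]
  convert this using 1
  · ring
  · ring

theorem posOn_branchPoly_two {a b : ℕ} (hab : 2 ≤ a + 2 * b) :
    PosOn 0 (a + 2 * b + 2)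
      ((1 + 2 * X - 2 * X ^ 2) * branchPoly a b + (1 + 2 * X) * (1 + X) * branchNum a b) := by
  rcases a with _ | a
  · obtain ⟨b, rfl⟩ : ∃ c, b = c + 1 := ⟨b - 1, by omega⟩
    have h4 : PosOn 0 4 (1 + 6 * X + 10 * X ^ 2 + 4 * X ^ 3 + 2 * X ^ 4 : ℝ[X]) := by
      convert ((((posOn_C (r := 2) two_pos).C_add_X_mul (r := 4) four_pos).C_add_X_mul (r := 10)
        (by norm_num)).C_add_X_mul (r := 6) (by norm_num)).C_add_X_mul one_pos using 1
      simp only [map_one, map_ofNat]; ring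
    have h1 := h4.mul (posOn_branchPoly 0 b) (by omega) (by omega)
    have h2 := ((posOn_one_add_two_X.mul posOn_one_add_X (by omega) (by omega)).mul posOn_quadratic
      (by omega) (by omega)).nonnegOn.mul (nonnegOn_branchNum 0 b)
    rw [branchPoly_succ_right, branchNum_succ_right]
    rw [show 0 + 2 * (b + 1) + 2 = 4 + (0 + 2 * b) by ring]
    convert h1.add_nonnegOn (h2.mono (by omega) (by omega)) using 1
    ring
  · have h1 := (posOn_one_add_X.mul posOn_one_add_three_X (by omega) (by omega)).mul
      (posOn_branchPoly a b) (by omega) (by omega)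
    have h2 := (posOn_one_add_two_X.mul (posOn_one_add_X.pow 2) (by omega) (by omega)).mul
      (posOn_branchNum (a := a) (b := b) (by omega)) (by omega) (by omega)
    rw [branchPoly_succ_left, branchNum_succ_left]
    have h3 := h1.add_posOn h2 (by omega) (by omega) (by omega)
    rw [show a + 1 + 2 * b + 2 = 0 + 1 + 2 * 1 + (a + 2 * b) by ring]
    convert h3 using 1
    ring

theorem posOn_branchDiff_two {A B : ℕ → ℕ} (h : 2 ≤ ∑ j ∈ range 5, (A j + 2 * B j)) :
    PosOn 2 (4 + ∑ j ∈ range 5, (A j + 2 * B j))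
      (branchDiff X (fun j => branchPoly (A j) (B j)) (fun j => branchNum (A j) (B j)) 2) := by
  have hsum : ∑ j ∈ range 5, (A j + 2 * B j) =
      (A 0 + A 1 + A 2 + A 3 + A 4) + 2 * (B 0 + B 1 + B 2 + B 3 + B 4) := by
    simp only [sum_range_succ, range_zero, sum_empty]; ring
  have hmain := (posOn_X_pow 2).mul (posOn_branchPoly_two (hsum ▸ h)) (by omega) (by omega)
  simp only [branchPoly_add, branchNum_add] at hmain
  rw [← hsum] at hmain
  have hp : ∀ j, NonnegOn 0 (A j + 2 * B j) (branchPoly (A j) (B j)) :=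
    fun j => (posOn_branchPoly _ _).nonnegOn
  have hH : ∀ j, NonnegOn 1 (A j + 2 * B j) (branchNum (A j) (B j)) :=
    fun j => nonnegOn_branchNum _ _
  have h0 := hp 0
  have h1 := hp 1
  have h2 := hp 2
  have h3 := hp 3
  have h4 := hp 4
  have i0 := hH 0
  have i1 := hH 1
  have i2 := hH 2
  have i3 := hH 3
  have i4 := hH 4
  simp only [branchDiff, transfer, prod_range_succ, range_zero, prod_empty]
  simp only [Nat.reduceAdd]
  generalize branchPoly (A 0) (B 0) = p0 at *
  generalize branchPoly (A 1) (B 1) = p1 at *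
  generalize branchPoly (A 2) (B 2) = p2 at *
  generalize branchPoly (A 3) (B 3) = p3 at *
  generalize branchPoly (A 4) (B 4) = p4 at *
  generalize branchNum (A 0) (B 0) = H0 at *
  generalize branchNum (A 1) (B 1) = H1 at *
  generalize branchNum (A 2) (B 2) = H2 at *
  generalize branchNum (A 3) (B 3) = H3 at *
  generalize branchNum (A 4) (B 4) = H4 at *
  have hs := posOn_one_add_two_X.nonnegOn
  have hX := posOn_X.nonnegOn
  have h1X := posOn_one_add_X.nonnegOn
  have hq := posOn_quadratic.nonnegOn
  have hα' : NonnegOn 1 (2 + (A 0 + 2 * B 0) + (A 1 + 2 * B 1))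
      (H0 * ((1 + X) * p1 + H1) + (1 + X) * (p0 * H1) + X * (p0 * H1)) :=
    (((i0.mul ((h1X.mul h1).add' i1)).add' (h1X.mul (h0.mul i1))).add'
      (hX.mul (h0.mul i1))).mono (by omega) (by omega)
  have hα : NonnegOn 0 (2 + (A 0 + 2 * B 0) + (A 1 + 2 * B 1))
      ((1 + 3 * X + X ^ 2) * (p0 * p1) +
        (H0 * ((1 + X) * p1 + H1) + (1 + X) * (p0 * H1) + X * (p0 * H1))) :=
    ((hq.mul (h0.mul h1)).add' hα').mono (by omega) (by omega)
  have hα'' : NonnegOn 0 (2 + (A 0 + 2 * B 0) + (A 1 + 2 * B 1))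
      ((1 + 2 * X) * (p0 * p1) +
        (H0 * ((1 + X) * p1 + H1) + (1 + X) * (p0 * H1) + X * (p0 * H1))) :=
    ((hs.mul (h0.mul h1)).add' hα').mono (by omega) (by omega)
  have hβ : NonnegOn 0 (2 + (A 0 + 2 * B 0) + (A 1 + 2 * B 1))
      (X * p1 * ((1 + X) * p0 + H0 + X * p0)) :=
    ((hX.mul h1).mul (((h1X.mul h0).add' i0).add' (hX.mul h0))).mono (by omega) (by omega)
  have hγ' : NonnegOn 1 (1 + (A 0 + 2 * B 0) + (A 1 + 2 * B 1))
      ((1 + X) * (H0 * p1 + p0 * H1) + H0 * H1) :=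
    ((h1X.mul ((i0.mul h1).add' (h0.mul i1))).add' (i0.mul i1)).mono (by omega) (by omega)
  have hγ : NonnegOn 0 (1 + (A 0 + 2 * B 0) + (A 1 + 2 * B 1))
      ((1 + 2 * X) * (p0 * p1) + ((1 + X) * (H0 * p1 + p0 * H1) + H0 * H1)) :=
    ((hs.mul (h0.mul h1)).add' hγ').mono (by omega) (by omega)
  have hδ' : NonnegOn 1 (1 + (A 0 + 2 * B 0) + (A 1 + 2 * B 1)) (X * p1 * H0) :=
    ((hX.mul h1).mul i0).mono (by omega) (by omega)
  have hδ : NonnegOn 0 (2 + (A 0 + 2 * B 0) + (A 1 + 2 * B 1))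
      (X * p1 * ((1 + X) * p0 + H0)) :=
    ((hX.mul h1).mul ((h1X.mul h0).add' i0)).mono (by omega) (by omega)
  have hY : NonnegOn 1 (4 + (A 0 + 2 * B 0) + (A 1 + 2 * B 1))
      (X * (1 + 2 * X) ^ 2 * (p0 * p1) + X ^ 3 * (H0 * p1) +
        X ^ 2 * (H0 * ((1 + X) * p1 + H1) + (1 + X) * (p0 * H1) + X * (p0 * H1)) +
        X * (1 + 2 * X) * ((1 + X) * (H0 * p1 + p0 * H1) + H0 * H1)) :=
    (((((hX.mul (posOn_one_add_two_X.pow 2).nonnegOn).mul (h0.mul h1)).add'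
      ((posOn_X_pow 3).nonnegOn.mul (i0.mul h1))).add' ((posOn_X_pow 2).nonnegOn.mul hα')).add'
      ((hX.mul hs).mul hγ')).mono (by omega) (by omega)
  have hbase := ((((hα.add' hβ).mul (i2.mul i4)).add'
    ((hX.mul (i2.mul h4)).mul (hγ.add' hδ))).add' ((hX.mul (i4.mul h2)).mul hα))
  have hrest := (i3.mul ((hbase.add' (((h1X.mul (hα.add' hβ)).mul
    ((i2.mul h4).add' (i4.mul h2))))).add' ((h2.mul h4).mul hY))).add' ((h3.mul hs).mul
    (((((hα.add' hβ).mul (i2.mul i4)).add' ((hX.mul (i2.mul h4)).mul (hγ.add' hδ'))).add'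
    ((hX.mul (i4.mul h2)).mul hα'')).add' ((posOn_X_pow 2).nonnegOn.mul
      ((h2.mul h4).mul (i0.mul i1)))))
  have htot : ∑ j ∈ range 5, (A j + 2 * B j) = (A 0 + 2 * B 0) + (A 1 + 2 * B 1) +
    (A 2 + 2 * B 2) + (A 3 + 2 * B 3) + (A 4 + 2 * B 4) := by
      simp only [sum_range_succ, range_zero, sum_empty]; ring
  have := hmain.add_nonnegOn (hrest.mono (by omega) (by rw [htot]; omega))
  rw [show 2 + 0 = 2 from rfl, show 2 + (∑ j ∈ range 5, (A j + 2 * B j) + 2) =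
    4 + ∑ j ∈ range 5, (A j + 2 * B j) by ring] at this
  convert this using 1
  ring

theorem posOn_branchDiff_two_of_eq_one {A B : ℕ → ℕ}
    (h : ∑ j ∈ range 5, (A j + 2 * B j) = 1) :
    PosOn 2 4
      (branchDiff X (fun j => branchPoly (A j) (B j)) (fun j => branchNum (A j) (B j)) 2) := by
  have hB : ∀ j, j < 5 → B j = 0 := fun j hj => by
    have : A j + 2 * B j ≤ ∑ j ∈ range 5, (A j + 2 * B j) :=
      single_le_sum (f := fun j => A j + 2 * B j) (fun _ _ => Nat.zero_le _) (mem_range.2 hj)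
    omega
  obtain ⟨i, hi, hA⟩ : ∃ i < 5, ∀ j < 5, A j = if j = i then 1 else 0 := by
    simp only [sum_range_succ, range_zero, sum_empty] at h
    have : ∃ i < 5, A i = 1 := by
      by_contra! hc
      have := hc 0; have := hc 1; have := hc 2; have := hc 3; have := hc 4
      omega
    obtain ⟨i, hi, hAi⟩ := this
    refine ⟨i, hi, fun j hj => ?_⟩
    split_ifs with hji
    · rw [hji, hAi]
    · interval_cases i <;> interval_cases j <;> omega
  have h1 : PosOn 0 2 (2 + 8 * X + 7 * X ^ 2 : ℝ[X]) := by
    convert ((posOn_C (r := 7) (by norm_num)).C_add_X_mul (r := 8) (by norm_num)).C_add_X_mul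
      (r := 2) two_pos using 1
    simp only [map_ofNat]; ring
  have h2 : PosOn 0 2 (1 + 4 * X + 3 * X ^ 2 : ℝ[X]) := by
    convert ((posOn_C (r := 3) (by norm_num)).C_add_X_mul (r := 4) (by norm_num)).C_add_X_mul
      one_pos using 1
    simp only [map_ofNat, map_one]; ring
  have h1' := (posOn_X_pow 2).mul h1 (by omega) (by omega)
  have h2' := (posOn_X_pow 2).mul h2 (by omega) (by omega)
  simp only [branchDiff, transfer, prod_range_succ, range_zero, prod_empty, Nat.reduceAdd]
  rw [hB 0 (by omega), hB 1 (by omega), hB 2 (by omega), hB 3 (by omega), hB 4 (by omega),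
    hA 0 (by omega), hA 1 (by omega), hA 2 (by omega), hA 3 (by omega), hA 4 (by omega)]
  interval_cases i <;>
    norm_num only [if_true, if_false, branchPoly_one_zero, branchPoly_zero, branchNum_one_zero,
      branchNum_zero]
  · convert h2' using 1; ring
  · convert h2' using 1; ring
  · convert h1' using 1; ring
  · convert h1' using 1; ring
  · convert h1' using 1; ring

end Polynomial

namespace Matrix

section Eliminate

variable {V R : Type*} [Fintype V] [DecidableEq V] [CommRing R]

/-- Block elimination of the indices outside of `p`: the column `Ψ y` extends the unit column at
`y` in such a way that the rows outside of `p` are annihilated. -/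
theorem det_eq_det_mul_det_of_annihilates (M : Matrix V V R) (p : V → Prop) [DecidablePred p]
    (Ψ : V → V → R) (h1 : ∀ x y, p x → p y → Ψ y x = if x = y then 1 else 0)
    (h2 : ∀ x y, ¬ p x → p y → ∑ z, M x z * Ψ y z = 0) :
    M.det = (of fun x y : {x // p x} => ∑ z, M x z * Ψ y z).det *
      (toSquareBlockProp M fun i => ¬ p i).det := by
  set Z : Matrix V V R := of fun x y => if p y then Ψ y x else if x = y then 1 else 0 with hZ
  have hZdet : Z.det = 1 := by
    rw [twoBlockTriangular_det' Z p (fun i hi j hj => by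
      simp only [hZ, of_apply, if_neg hj]
      exact if_neg fun h : i = j => hj (h ▸ hi))]
    have e1 : toSquareBlockProp Z p = 1 := by
      ext x y
      simp only [toSquareBlockProp_def, hZ, of_apply, if_pos y.2, h1 _ _ x.2 y.2, one_apply,
        Subtype.ext_iff]
    have e2 : (toSquareBlockProp Z fun i => ¬ p i) = 1 := by
      ext x y
      simp only [toSquareBlockProp_def, hZ, of_apply, if_neg y.2, one_apply, Subtype.ext_iff]
    rw [e1, e2, det_one, det_one, one_mul]
  have hMZ : ∀ x y, (M * Z) x y = if p y then ∑ z, M x z * Ψ y z else M x y := by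
    intro x y
    rw [mul_apply]
    split_ifs with hy
    · exact sum_congr rfl fun z _ => by simp only [hZ, of_apply, if_pos hy]
    · simp [hZ, of_apply, if_neg hy]
  rw [← mul_one M.det, ← hZdet, ← det_mul, twoBlockTriangular_det (M * Z) p
    (fun i hi j hj => by rw [hMZ, if_pos hj, h2 i j hi hj])]
  congr 2
  · ext x y
    simp only [toSquareBlockProp_def, of_apply, hMZ, if_pos y.2]
  · ext x y
    simp only [toSquareBlockProp_def, of_apply, hMZ, if_neg y.2]

theorem det_subtype_three {u v w : V} (huv : u ≠ v) (huw : u ≠ w) (hvw : v ≠ w)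
    (F : V → V → R) :
    (of fun x y : {x // x = u ∨ x = v ∨ x = w} => F x y).det =
      F u u * F v v * F w w - F u u * F v w * F w v - F u v * F v u * F w w +
        F u v * F v w * F w u + F u w * F v u * F w v - F u w * F v v * F w u := by
  let f : Fin 3 → {x // x = u ∨ x = v ∨ x = w} :=
    ![⟨u, Or.inl rfl⟩, ⟨v, Or.inr (Or.inl rfl)⟩, ⟨w, Or.inr (Or.inr rfl)⟩]
  have hf : Function.Bijective f := by
    constructor
    · intro i j hij
      fin_cases i <;> fin_cases j <;> simp_all [f, Subtype.ext_iff]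
    · rintro ⟨x, rfl | rfl | rfl⟩
      · exact ⟨0, rfl⟩
      · exact ⟨1, rfl⟩
      · exact ⟨2, rfl⟩
  rw [← det_submatrix_equiv_self (Equiv.ofBijective f hf), det_fin_three]
  simp [f]

theorem det_eq_of_annihilates_three {u v w : V} (huv : u ≠ v) (huw : u ≠ w) (hvw : v ≠ w)
    (M : Matrix V V R) (Ψ : V → V → R)
    (h1 : ∀ x y, (x = u ∨ x = v ∨ x = w) → (y = u ∨ y = v ∨ y = w) →
      Ψ y x = if x = y then 1 else 0)
    (h2 : ∀ x y, ¬ (x = u ∨ x = v ∨ x = w) → (y = u ∨ y = v ∨ y = w) → ∑ z, M x z * Ψ y z = 0)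
    {F : V → V → R} (hF : ∀ x y, F x y = ∑ z, M x z * Ψ y z) :
    M.det = (F u u * F v v * F w w - F u u * F v w * F w v - F u v * F v u * F w w +
        F u v * F v w * F w u + F u w * F v u * F w v - F u w * F v v * F w u) *
      (toSquareBlockProp M fun i => ¬ (i = u ∨ i = v ∨ i = w)).det := by
  rw [← det_subtype_three huv huw hvw F]
  simp only [hF]
  exact det_eq_det_mul_det_of_annihilates M (fun x => x = u ∨ x = v ∨ x = w) Ψ h1 h2

theorem sum_eq_three_add {u v w : V} (huv : u ≠ v) (huw : u ≠ w) (hvw : v ≠ w) (F : V → R) :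
    ∑ z, F z = F u + F v + F w + ∑ z with ¬ (z = u ∨ z = v ∨ z = w), F z := by
  have h : (univ.filter fun z => z = u ∨ z = v ∨ z = w) = {u, v, w} := by
    ext z; simp
  rw [← sum_filter_add_sum_filter_not univ (fun z => z = u ∨ z = v ∨ z = w), h,
    sum_insert (by simp [huv, huw]), sum_insert (by simp [hvw]), sum_singleton]
  ring

/-- The matrix `1 + t Q` for the signless Laplacian `Q` of the weighted graph with adjacency
matrix `a`. -/
def oneAddSmulLap (t : R) (a : V → V → R) : Matrix V V R :=
  of fun x y => (if x = y then 1 + t * ∑ z, a x z else 0) + t * a x y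

theorem sum_oneAddSmulLap_mul (t : R) (a : V → V → R) (x : V) (F : V → R) :
    ∑ z, oneAddSmulLap t a x z * F z = F x + t * ∑ z, a x z * (F x + F z) := by
  simp only [oneAddSmulLap, of_apply, add_mul, ite_mul, zero_mul, sum_add_distrib, sum_ite_eq,
    mem_univ, if_true, mul_add, mul_sum, mul_assoc, sum_mul, one_mul]
  ring

/-- The effect on `det (1 + t Q)` of moving all the edges at `v` and `w` to `u`, except for those
of the path `u v w`. The columns `Ψu, Ψv, Ψw` are harmonic outside of `u, v, w`. -/
theorem det_oneAddSmulLap_sub (t : R) {a a' : V → V → R} {u v w : V} (huv : u ≠ v) (huw : u ≠ w)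
    (hvw : v ≠ w) (symm : ∀ x y, a x y = a y x) (symm' : ∀ x y, a' x y = a' y x)
    (irr : ∀ x, a x x = 0) (irr' : ∀ x, a' x x = 0)
    (hauv : a u v = 1) (havw : a v w = 1) (hauw : a u w = 0)
    (hauv' : a' u v = 1) (havw' : a' v w = 1) (hauw' : a' u w = 0)
    (hu : ∀ x, ¬ (x = u ∨ x = v ∨ x = w) → a' x u = a x u + a x v + a x w)
    (hv : ∀ x, ¬ (x = u ∨ x = v ∨ x = w) → a' x v = 0)
    (hw : ∀ x, ¬ (x = u ∨ x = v ∨ x = w) → a' x w = 0)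
    (hS : ∀ x y, ¬ (x = u ∨ x = v ∨ x = w) → ¬ (y = u ∨ y = v ∨ y = w) → a' x y = a x y)
    {Ψu Ψv Ψw : V → R}
    (huu : Ψu u = 1) (huv0 : Ψu v = 0) (huw0 : Ψu w = 0)
    (hvu : Ψv u = 0) (hvv : Ψv v = 1) (hvw0 : Ψv w = 0)
    (hwu : Ψw u = 0) (hwv : Ψw v = 0) (hww : Ψw w = 1)
    (hΨu : ∀ x, ¬ (x = u ∨ x = v ∨ x = w) → ∑ z, oneAddSmulLap t a x z * Ψu z = 0)
    (hΨv : ∀ x, ¬ (x = u ∨ x = v ∨ x = w) → ∑ z, oneAddSmulLap t a x z * Ψv z = 0)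
    (hΨw : ∀ x, ¬ (x = u ∨ x = v ∨ x = w) → ∑ z, oneAddSmulLap t a x z * Ψw z = 0)
    {x y z c : R}
    (kuu : t * ∑ i with ¬ (i = u ∨ i = v ∨ i = w), a u i * (1 + Ψu i) = x)
    (kvv : t * ∑ i with ¬ (i = u ∨ i = v ∨ i = w), a v i * (1 + Ψv i) = y)
    (kww : t * ∑ i with ¬ (i = u ∨ i = v ∨ i = w), a w i * (1 + Ψw i) = z)
    (kuw : t * ∑ i with ¬ (i = u ∨ i = v ∨ i = w), a u i * Ψw i = c)
    (kwu : t * ∑ i with ¬ (i = u ∨ i = v ∨ i = w), a w i * Ψu i = c)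
    (kuv : t * ∑ i with ¬ (i = u ∨ i = v ∨ i = w), a u i * Ψv i = 0)
    (kvu : t * ∑ i with ¬ (i = u ∨ i = v ∨ i = w), a v i * Ψu i = 0)
    (kvw : t * ∑ i with ¬ (i = u ∨ i = v ∨ i = w), a v i * Ψw i = 0)
    (kwv : t * ∑ i with ¬ (i = u ∨ i = v ∨ i = w), a w i * Ψv i = 0) :
    (oneAddSmulLap t a).det - (oneAddSmulLap t a').det =
      (toSquareBlockProp (oneAddSmulLap t a) fun i => ¬ (i = u ∨ i = v ∨ i = w)).det *
        (y * (x * z - c ^ 2 + (1 + t) * (x + z) - t) + (1 + 2 * t) * (x * z - c ^ 2) -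
          2 * c * (1 + 3 * t)) := by
  have hN : (toSquareBlockProp (oneAddSmulLap t a') fun i => ¬ (i = u ∨ i = v ∨ i = w)) =
      toSquareBlockProp (oneAddSmulLap t a) fun i => ¬ (i = u ∨ i = v ∨ i = w) := by
    ext i j
    have hdeg : ∑ z, a' i z = ∑ z, a i z := by
      rw [sum_eq_three_add huv huw hvw, sum_eq_three_add huv huw hvw (fun z => a i z),
        hu i i.2, hv i i.2, hw i i.2, add_zero, add_zero]
      congr 1
      exact sum_congr rfl fun z hz => hS _ _ i.2 (mem_filter.1 hz).2
    simp only [toSquareBlockProp_def, oneAddSmulLap, of_apply, hdeg, hS _ _ i.2 j.2]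
  rw [det_eq_of_annihilates_three huv huw hvw (oneAddSmulLap t a)
      (fun k => if k = u then Ψu else if k = v then Ψv else Ψw)
      (by
        rintro i j (rfl | rfl | rfl) (rfl | rfl | rfl) <;>
          simp [*, huv.symm, huw.symm, hvw.symm])
      (by
        rintro i j hi (rfl | rfl | rfl)
        · simpa using hΨu i hi
        · simpa [huv.symm] using hΨv i hi
        · simpa [huw.symm, hvw.symm] using hΨw i hi) (fun _ _ => rfl),
    det_eq_of_annihilates_three huv huw hvw (oneAddSmulLap t a')
      (fun k i => if i = u ∨ i = v ∨ i = w then if i = k then 1 else 0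
        else if k = u then Ψu i + Ψv i + Ψw i else 0)
      (by
        intro i j hi hj
        simp only [if_pos hi])
      (by
        rintro i j hi hj
        rw [sum_eq_three_add huv huw hvw]
        have hSsum : ∀ F : V → R, (∑ z with ¬ (z = u ∨ z = v ∨ z = w),
            oneAddSmulLap t a' i z * (if z = u ∨ z = v ∨ z = w then if z = j then 1 else 0
              else F z)) =
            ∑ z with ¬ (z = u ∨ z = v ∨ z = w), oneAddSmulLap t a i z * F z := by
          intro F
          refine sum_congr rfl fun z hz => ?_
          have hz' := (mem_filter.1 hz).2
          rw [if_neg hz']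
          congr 1
          exact congrFun (congrFun hN ⟨i, hi⟩) ⟨z, hz'⟩
        rw [hSsum]
        have e1 := hΨu i hi
        have e2 := hΨv i hi
        have e3 := hΨw i hi
        rw [sum_eq_three_add huv huw hvw] at e1 e2 e3
        rw [not_or, not_or] at hi
        have hi' : ¬ (i = u ∨ i = v ∨ i = w) := by tauto
        simp only [oneAddSmulLap, of_apply, if_neg hi.1, if_neg hi.2.1, if_neg hi.2.2, huu, huv0,
          huw0, hvu, hvv, hvw0, hwu, hwv, hww] at e1 e2 e3
        rcases hj with rfl | rfl | rfl
        · simp only [oneAddSmulLap, of_apply, if_neg hi.1, if_neg hi.2.1, if_neg hi.2.2, true_or,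
            or_true, if_true, hu _ hi', huv.symm, huw.symm, if_false, mul_add, sum_add_distrib]
          linear_combination e1 + e2 + e3
        · simp only [oneAddSmulLap, of_apply, if_neg hi.1, if_neg hi.2.1, if_neg hi.2.2, true_or,
            or_true, if_true, hv _ hi', huv, huv.symm, hvw.symm, if_false, mul_zero,
            sum_const_zero, add_zero, zero_mul]
        · simp only [oneAddSmulLap, of_apply, if_neg hi.1, if_neg hi.2.1, if_neg hi.2.2, true_or,
            or_true, if_true, hw _ hi', huw, hvw, huw.symm, if_false, mul_zero,
            sum_const_zero, add_zero, zero_mul])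
      (fun _ _ => rfl), hN]
  simp only [sum_oneAddSmulLap_mul, if_true, huv.symm, huw.symm, hvw.symm, if_false, true_or,
    or_true, huv, huw, hvw]
  simp only [sum_eq_three_add huv huw hvw, huu, huv0, huw0, hvu, hvv, hvw0, hwu, hwv, hww, irr,
    irr', hauv, havw, hauw, hauv', havw', hauw', symm v u, symm w u, symm w v, symm' v u,
    symm' w u, symm' w v, true_or, or_true, if_true, huv.symm, huw.symm, hvw.symm, if_false, huv,
    huw, hvw]
  have hfil : ∀ b : V → R, ∀ k : R, ∀ F : V → R, ∀ j : V,
      ∑ i with ¬ (i = u ∨ i = v ∨ i = w), b i *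
        (k + if i = u ∨ i = v ∨ i = w then if i = j then 1 else 0 else F i) =
      ∑ i with ¬ (i = u ∨ i = v ∨ i = w), b i * (k + F i) :=
    fun b k F j => sum_congr rfl fun i hi => by rw [if_neg (mem_filter.1 hi).2]
  simp only [hfil]
  have hau' : ∀ k : R, ∀ F : V → R, ∑ i with ¬ (i = u ∨ i = v ∨ i = w), a' u i * (k + F i) =
      ∑ i with ¬ (i = u ∨ i = v ∨ i = w), (a u i + a v i + a w i) * (k + F i) :=
    fun k F => sum_congr rfl fun i hi => by
      rw [symm' u i, hu i (mem_filter.1 hi).2, symm i u, symm i v, symm i w]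
  have hav' : ∀ k : R, ∀ F : V → R,
      ∑ i with ¬ (i = u ∨ i = v ∨ i = w), a' v i * (k + F i) = 0 :=
    fun k F => sum_eq_zero fun i hi => by
      rw [symm' v i, hv i (mem_filter.1 hi).2, zero_mul]
  have haw' : ∀ k : R, ∀ F : V → R,
      ∑ i with ¬ (i = u ∨ i = v ∨ i = w), a' w i * (k + F i) = 0 :=
    fun k F => sum_eq_zero fun i hi => by
      rw [symm' w i, hw i (mem_filter.1 hi).2, zero_mul]
  have hexp : ∑ i with ¬ (i = u ∨ i = v ∨ i = w),
      (a u i + a v i + a w i) * (1 + (Ψu i + Ψv i + Ψw i)) =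
      ∑ i with ¬ (i = u ∨ i = v ∨ i = w), a u i * (1 + Ψu i) +
      ∑ i with ¬ (i = u ∨ i = v ∨ i = w), a v i * (1 + Ψv i) +
      ∑ i with ¬ (i = u ∨ i = v ∨ i = w), a w i * (1 + Ψw i) +
      ∑ i with ¬ (i = u ∨ i = v ∨ i = w), a u i * Ψv i +
      ∑ i with ¬ (i = u ∨ i = v ∨ i = w), a u i * Ψw i +
      ∑ i with ¬ (i = u ∨ i = v ∨ i = w), a v i * Ψu i +
      ∑ i with ¬ (i = u ∨ i = v ∨ i = w), a v i * Ψw i +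
      ∑ i with ¬ (i = u ∨ i = v ∨ i = w), a w i * Ψu i +
      ∑ i with ¬ (i = u ∨ i = v ∨ i = w), a w i * Ψv i := by
    simp only [← sum_add_distrib]
    exact sum_congr rfl fun i _ => by ring
  simp only [hau', hav', haw', hexp]
  simp only [mul_add t, kuu, kvv, kww, kuw, kwu, kuv, kvu, kvw, kwv, zero_add, add_zero, mul_zero,
    mul_one, sum_const_zero]
  ring

/-- The determinant of a symmetric matrix supported on a rooted forest, with `P x y` saying that
`y` is the parent of `x`, is the product of the pivots of the elimination towards the roots. -/
theorem det_forest (t : ℝ) {d : V → ℝ} (hd : ∀ x, d x ≠ 0) {P : V → V → Prop}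
    [∀ x y, Decidable (P x y)] (huniq : ∀ x y z, P x y → P x z → y = z) (ht : V → ℕ)
    (hht : ∀ x y, P x y → ht x < ht y) {N : Matrix V V ℝ}
    (hdiag : ∀ x, N x x = d x + ∑ y with P y x, t ^ 2 / d y)
    (hoff : ∀ x y, x ≠ y → N x y = (if P x y then t else 0) + (if P y x then t else 0)) :
    N.det = ∏ x, d x := by
  have hirr : ∀ x, ¬ P x x := fun x h => lt_irrefl _ (hht x x h)
  set L : Matrix V V ℝ := of fun x y =>
    (if x = y then 1 else 0) + (if P y x then t / d y else 0) with hL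
  have hLdet : L.det = 1 := by
    have htri : Lᵀ.BlockTriangular ht := by
      intro i j hij
      have h1 : ¬ P i j := fun h => lt_asymm hij (hht _ _ h)
      have h2 : j ≠ i := fun h => by simp [h] at hij
      simp [hL, h1, h2]
    rw [← det_transpose, htri.det]
    refine prod_eq_one fun k _ => ?_
    have : Lᵀ.toSquareBlock ht k = 1 := by
      ext i j
      have h1 : ¬ P i j := fun h => by
        have := hht _ _ h
        rw [i.2, j.2] at this
        exact lt_irrefl _ this
      simp [hL, toSquareBlock_def, h1, one_apply, Subtype.ext_iff, eq_comm]
    rw [this, det_one]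
  have hfac : N = L * diagonal d * Lᵀ := by
    ext x y
    have hsum : (L * diagonal d * Lᵀ) x y =
        (if x = y then d x else 0) + (if P x y then t else 0) + (if P y x then t else 0) +
          ∑ z with P z x ∧ P z y, t ^ 2 / d z := by
      rw [mul_apply]
      simp only [mul_diagonal, transpose_apply]
      have : ∀ z, L x z * d z * L y z =
          (if z = x then if x = y then d x else 0 else 0) +
          (if z = x then if P x y then t else 0 else 0) +
          (if z = y then if P y x then t else 0 else 0) +
          (if P z x ∧ P z y then t ^ 2 / d z else 0) := by
        intro z
        have hz := hd z
        simp only [hL, of_apply]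
        by_cases hzx : z = x
        · subst hzx
          by_cases hzy : z = y
          · subst hzy
            simp [hirr]
          · have : y ≠ z := Ne.symm hzy
            by_cases h : P z y <;> simp [hirr, hzy, this, h, mul_div_cancel₀ _ hz]
        · have hxz : x ≠ z := Ne.symm hzx
          by_cases hzy : z = y
          · subst hzy
            by_cases h : P z x <;> simp [hirr, hzx, hxz, h, div_mul_cancel₀ _ hz]
          · have hyz : y ≠ z := Ne.symm hzy
            by_cases h : P z x <;> by_cases h' : P z y <;> simp [hzx, hxz, hzy, hyz, h, h']
            field_simp
      simp only [this, sum_add_distrib, sum_ite_eq', mem_univ, if_true, sum_filter]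
    rw [hsum]
    by_cases hxy : x = y
    · subst hxy
      simp [hdiag, hirr]
    · rw [hoff x y hxy, if_neg hxy, zero_add]
      rw [filter_false_of_mem (fun z _ h => hxy (huniq _ _ _ h.1 h.2)), sum_empty, add_zero]
  rw [hfac, det_mul, det_mul, det_transpose, hLdet, det_diagonal, one_mul, mul_one]

end Eliminate

end Matrix

/-- `x` is none of the vertices `c 0, …, c (n - 1)`. -/
def IsOff {V : Type*} (c : ℕ → V) (n : ℕ) (x : V) : Prop := ∀ i < n, c i ≠ x

/-- The graph of the map `par` is a cycle `c 0, …, c (m + 2)` with paths of length at most two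
attached to it. -/
structure IsCycleWithPaths {V : Type*} (par : V → V) (c : ℕ → V) (m : ℕ) : Prop where
  inj : ∀ i < m + 3, ∀ j < m + 3, c i = c j → i = j
  par_apply : ∀ i < m + 3, par (c i) = c (i + 1)
  wrap : c (m + 3) = c 0
  par_par : ∀ x, IsOff c (m + 3) x → IsOff c (m + 3) (par x) → ¬ IsOff c (m + 3) (par (par x))
  leaf : ∀ x, IsOff c (m + 3) x → IsOff c (m + 3) (par x) → ∀ y, par y ≠ x
  unique : ∀ x, IsOff c (m + 3) x → ∀ y z, par y = x → par z = x → y = z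

theorem eq_or_isOff {V : Type*} (c : ℕ → V) (n : ℕ) (x : V) :
    (∃ i < n, x = c i) ∨ IsOff c n x := by
  by_cases h : ∃ i < n, x = c i
  · exact Or.inl h
  · exact Or.inr fun i hi h' => h ⟨i, hi, h'.symm⟩

theorem not_isOff {V : Type*} {c : ℕ → V} {n i : ℕ} (hi : i < n) : ¬ IsOff c n (c i) :=
  fun h => h i hi rfl

open Classical in
theorem exists_eq_on_cycle_and_off {V α : Type*} {c : ℕ → V} {n : ℕ}
    (inj : ∀ i < n, ∀ j < n, c i = c j → i = j) (g : ℕ → α) (k : V → α) :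
    ∃ f : V → α, (∀ i < n, f (c i) = g i) ∧ ∀ z, IsOff c n z → f z = k z := by
  refine ⟨fun x => if h : ∃ i < n, c i = x then g h.choose else k x, fun i hi => ?_,
    fun z hz => ?_⟩
  · have h : ∃ j < n, c j = c i := ⟨i, hi, rfl⟩
    simp only [dif_pos h]
    rw [inj _ h.choose_spec.1 _ hi h.choose_spec.2]
  · have h : ¬ ∃ i < n, c i = z := by rintro ⟨i, hi, h⟩; exact hz i hi h
    simp only [dif_neg h]

namespace IsCycleWithPaths

section

variable {V : Type*} {par : V → V} {c : ℕ → V} {m : ℕ} (H : IsCycleWithPaths par c m)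
include H

theorem not_off_par {i : ℕ} (hi : i < m + 3) : ¬ IsOff c (m + 3) (par (c i)) := by
  rw [H.par_apply i hi]
  rcases Nat.lt_or_ge (i + 1) (m + 3) with h | h
  · exact not_isOff h
  · rw [show i + 1 = m + 3 by omega, H.wrap]
    exact not_isOff (by omega)

theorem off_of_par_off {x : V} (h : IsOff c (m + 3) (par x)) : IsOff c (m + 3) x := by
  rcases eq_or_isOff c (m + 3) x with ⟨i, hi, rfl⟩ | h'
  · exact absurd h (H.not_off_par hi)
  · exact h'

theorem inj_succ {i j : ℕ} (hi : i < m + 3) (hj : j < m + 3) (h : c (i + 1) = c (j + 1)) :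
    i = j := by
  rcases Nat.lt_or_ge (i + 1) (m + 3) with h1 | h1 <;>
    rcases Nat.lt_or_ge (j + 1) (m + 3) with h2 | h2
  · have := H.inj _ h1 _ h2 h
    omega
  · rw [show j + 1 = m + 3 by omega, H.wrap] at h
    have := H.inj _ h1 _ (by omega) h
    omega
  · rw [show i + 1 = m + 3 by omega, H.wrap] at h
    have := H.inj _ (by omega) _ h2 h
    omega
  · omega

theorem par_ne (x : V) : par x ≠ x := by
  intro h
  rcases eq_or_isOff c (m + 3) x with ⟨i, hi, rfl⟩ | h'
  · rw [H.par_apply i hi] at h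
    rcases Nat.lt_or_ge (i + 1) (m + 3) with h1 | h1
    · have := H.inj _ h1 _ hi h
      omega
    · rw [show i + 1 = m + 3 by omega, H.wrap] at h
      have := H.inj _ (by omega) _ hi h
      omega
  · have h1 : IsOff c (m + 3) (par x) := h.symm ▸ h'
    have h2 := H.par_par x h' h1
    rw [h] at h2
    exact h2 h1

theorem par_par_ne (x : V) : par (par x) ≠ x := by
  intro h
  rcases eq_or_isOff c (m + 3) x with ⟨i, hi, rfl⟩ | h'
  · rw [H.par_apply i hi] at h
    rcases Nat.lt_or_ge (i + 1) (m + 3) with h1 | h1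
    · rw [H.par_apply _ h1] at h
      rcases Nat.lt_or_ge (i + 2) (m + 3) with h2 | h2
      · have := H.inj _ h2 _ hi h
        omega
      · rw [show i + 1 + 1 = m + 3 by omega, H.wrap] at h
        have := H.inj _ (by omega) _ hi h
        omega
    · rw [show i + 1 = m + 3 by omega, H.wrap, H.par_apply 0 (by omega)] at h
      have := H.inj _ (by omega) _ hi h
      omega
  · have h1 : IsOff c (m + 3) (par x) := H.off_of_par_off (x := par x) (h.symm ▸ h')
    exact H.leaf x h' h1 _ h

end

section Sums

variable {V : Type*} [Fintype V] {par : V → V} {c : ℕ → V} {m : ℕ}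

open Classical in
/-- The children of `x` off the cycle. -/
noncomputable def branches (par : V → V) (c : ℕ → V) (m : ℕ) (x : V) : Finset V :=
  univ.filter fun z => IsOff c (m + 3) z ∧ par z = x

open Classical in
/-- The pivot of the vertex `z` off the cycle in the elimination of `1 + t Q`. -/
noncomputable def pivot (par : V → V) (c : ℕ → V) (m : ℕ) (t : ℝ) (z : V) : ℝ :=
  if branches par c m z = ∅ then 1 + t else (1 + 3 * t + t ^ 2) / (1 + t)

/-- What the branches at the vertex `x` of the cycle contribute to its pivot. -/
noncomputable def load (par : V → V) (c : ℕ → V) (m : ℕ) (t : ℝ) (x : V) : ℝ :=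
  ∑ z ∈ branches par c m x, (t - t ^ 2 / pivot par c m t z)

open Classical in
/-- The adjacency matrix of the graph of `par`. -/
noncomputable def parAdj (par : V → V) (x y : V) : ℝ := if par x = y ∨ par y = x then 1 else 0

theorem mem_branches {x z : V} : z ∈ branches par c m x ↔ IsOff c (m + 3) z ∧ par z = x := by
  simp [branches]

variable (H : IsCycleWithPaths par c m)
include H

theorem branches_eq_empty {x : V} (hx : IsOff c (m + 3) x) (hp : IsOff c (m + 3) (par x)) :
    branches par c m x = ∅ :=
  eq_empty_of_forall_notMem fun z hz => H.leaf x hx hp z (mem_branches.1 hz).2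

open Classical in
theorem filter_par_eq_of_off {x : V} (hx : IsOff c (m + 3) x) :
    (univ.filter fun z => par z = x) = branches par c m x := by
  ext z
  simp only [mem_filter, mem_univ, true_and, mem_branches]
  exact ⟨fun h => ⟨H.off_of_par_off (h.symm ▸ hx), h⟩, fun h => h.2⟩

open Classical in
theorem sum_filter_par_cycle {i : ℕ} (hi : i < m + 3) (F : V → ℝ) :
    ∑ z with par z = c (i + 1), F z = F (c i) + ∑ z ∈ branches par c m (c (i + 1)), F z := by
  have : (univ.filter fun z => par z = c (i + 1)) =
      insert (c i) (branches par c m (c (i + 1))) := by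
    ext z
    simp only [mem_filter, mem_univ, true_and, mem_insert, mem_branches]
    constructor
    · intro h
      rcases eq_or_isOff c (m + 3) z with ⟨j, hj, rfl⟩ | hz
      · rw [H.par_apply j hj] at h
        exact Or.inl (by rw [H.inj_succ hj hi h])
      · exact Or.inr ⟨hz, h⟩
    · rintro (rfl | h)
      · exact H.par_apply i hi
      · exact h.2
  rw [this, sum_insert]
  exact fun h => not_isOff hi (mem_branches.1 h).1

open Classical in
theorem sum_parAdj_mul (x : V) (F : V → ℝ) :
    ∑ z, parAdj par x z * F z = F (par x) + ∑ z with par z = x, F z := by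
  have : ∀ z, parAdj par x z * F z =
      (if par x = z then F z else 0) + (if par z = x then F z else 0) := by
    intro z
    rw [parAdj]
    by_cases h1 : par x = z
    · have h2 : par z ≠ x := fun h => H.par_par_ne x (by rw [h1, h])
      simp [h1, h2]
    · simp [h1]
  simp only [this, sum_add_distrib, sum_ite_eq, mem_univ, if_true, sum_filter]

theorem pivot_of_par_off {t : ℝ} {z : V} (hp : IsOff c (m + 3) (par z)) :
    pivot par c m t z = 1 + t := by
  rw [pivot, if_pos (H.branches_eq_empty (H.off_of_par_off hp) hp)]

theorem card_branches_le_one {x : V} (hx : IsOff c (m + 3) x) : #(branches par c m x) ≤ 1 :=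
  card_le_one.2 fun a ha b hb => H.unique x hx a b (mem_branches.1 ha).2 (mem_branches.1 hb).2

theorem one_add_card_branches {t : ℝ} (ht : 0 < t) {x : V} (hx : IsOff c (m + 3) x) :
    1 + t * (1 + #(branches par c m x)) =
      pivot par c m t x + ∑ z ∈ branches par c m x, t ^ 2 / pivot par c m t z := by
  have h1 : ∀ z ∈ branches par c m x, t ^ 2 / pivot par c m t z = t ^ 2 / (1 + t) := by
    intro z hz
    rw [H.pivot_of_par_off]
    rwa [(mem_branches.1 hz).2]
  rw [sum_congr rfl h1, sum_const, nsmul_eq_mul]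
  by_cases h : branches par c m x = ∅
  · simp [pivot, h]
  · have hc : #(branches par c m x) = 1 :=
      le_antisymm (H.card_branches_le_one hx) (card_pos.2 (nonempty_iff_ne_empty.2 h))
    rw [pivot, if_neg h, hc]
    field_simp
    push_cast
    ring

omit H in
theorem pivot_pos {t : ℝ} (ht : 0 < t) (z : V) : 0 < pivot par c m t z := by
  rw [pivot]
  split_ifs <;> positivity

omit H in
theorem load_nonneg {t : ℝ} (ht : 0 < t) (x : V) : 0 ≤ load par c m t x := by
  refine sum_nonneg fun z _ => ?_
  rw [sub_nonneg, div_le_iff₀ (pivot_pos ht z), pivot]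
  split_ifs
  · nlinarith
  · rw [← mul_div_assoc, le_div_iff₀ (by positivity)]
    nlinarith [pow_pos ht 3, pow_pos ht 2]

theorem harmonic_off {t : ℝ} (ht : 0 < t) {φ : V → ℝ}
    (hφ : ∀ z, IsOff c (m + 3) z → φ z = -t / pivot par c m t z * φ (par z)) {x : V}
    (hx : IsOff c (m + 3) x) :
    φ x + t * ∑ z, parAdj par x z * (φ x + φ z) = 0 := by
  have h1 := H.one_add_card_branches ht hx
  have hp := (pivot_pos (par := par) (c := c) (m := m) ht x).ne'
  rw [H.sum_parAdj_mul, H.filter_par_eq_of_off hx, sum_add_distrib, sum_const, nsmul_eq_mul]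
  have h2 : ∑ z ∈ branches par c m x, φ z =
      -(∑ z ∈ branches par c m x, t ^ 2 / pivot par c m t z) * φ x / t := by
    rw [neg_mul, sum_mul, neg_div, sum_div, ← sum_neg_distrib]
    refine sum_congr rfl fun z hz => ?_
    rw [hφ z (mem_branches.1 hz).1, (mem_branches.1 hz).2]
    field_simp
  have h3 : pivot par c m t x * φ x = -t * φ (par x) := by
    rw [hφ x hx]; field_simp
  rw [h2]
  have h4 : t * (-(∑ z ∈ branches par c m x, t ^ 2 / pivot par c m t z) * φ x / t) =
      -(∑ z ∈ branches par c m x, t ^ 2 / pivot par c m t z) * φ x := by field_simp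
  linear_combination h4 + φ x * h1 + h3

omit H in
theorem sum_branches_harmonic {t : ℝ} {φ : V → ℝ}
    (hφ : ∀ z, IsOff c (m + 3) z → φ z = -t / pivot par c m t z * φ (par z)) (x : V) (e : ℝ) :
    t * ∑ z ∈ branches par c m x, (e + φ z) =
      load par c m t x * φ x + t * #(branches par c m x) * (e - φ x) := by
  rw [load, sum_mul, mul_sum, mul_assoc, ← nsmul_eq_mul, ← sum_const, mul_sum, ← sum_add_distrib]
  refine sum_congr rfl fun z hz => ?_
  rw [hφ z (mem_branches.1 hz).1, (mem_branches.1 hz).2]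
  ring

theorem action_cycle {t : ℝ} {φ : V → ℝ}
    (hφ : ∀ z, IsOff c (m + 3) z → φ z = -t / pivot par c m t z * φ (par z)) {i : ℕ}
    (hi : i < m + 3) :
    φ (c (i + 1)) + t * ∑ z, parAdj par (c (i + 1)) z * (φ (c (i + 1)) + φ z) =
      (1 + 2 * t + load par c m t (c (i + 1))) * φ (c (i + 1)) + t * φ (c i) +
        t * φ (par (c (i + 1))) := by
  rw [H.sum_parAdj_mul, H.sum_filter_par_cycle hi]
  linear_combination sum_branches_harmonic hφ (c (i + 1)) (φ (c (i + 1)))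

end Sums

end IsCycleWithPaths

namespace IsCycleWithPaths

section Harmonic

variable {V : Type*} [Fintype V] {par : V → V} {c : ℕ → V} {m : ℕ}

/-- The transfer sequence of the vertices `c 0, …, c (m - 1)`. -/
noncomputable def seq (par : V → V) (c : ℕ → V) (m : ℕ) (t x y : ℝ) (j : ℕ) : ℝ × ℝ :=
  transfer t 1 (fun i => load par c m t (c i)) x y j

theorem seq_succ_fst_add_snd (t x y : ℝ) (j : ℕ) :
    (seq par c m t x y (j + 1)).1 + (seq par c m t x y (j + 1)).2 =
      (1 + 2 * t + load par c m t (c j)) *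
        ((seq par c m t x y j).1 + (seq par c m t x y j).2) - t * (seq par c m t x y j).2 := by
  simp only [seq, transfer, Pi.one_apply]; ring

theorem seq_succ_snd (t x y : ℝ) (j : ℕ) :
    (seq par c m t x y (j + 1)).2 =
      t * ((seq par c m t x y j).1 + (seq par c m t x y j).2) := by
  simp only [seq, transfer, Pi.one_apply]; ring

theorem seq_pos {t : ℝ} (ht : 0 < t) (j : ℕ) :
    0 < (seq par c m t 1 0 j).1 ∧ 0 ≤ (seq par c m t 1 0 j).2 := by
  induction j with
  | zero => simp [seq, transfer]
  | succ j ih =>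
    have hl := load_nonneg (par := par) (c := c) (m := m) ht (c j)
    obtain ⟨h1, h2⟩ := ih
    simp only [seq, transfer, Pi.one_apply] at h1 h2 ⊢
    constructor <;> positivity

theorem seq_sum_pos {t : ℝ} (ht : 0 < t) (j : ℕ) :
    0 < (seq par c m t 1 0 j).1 + (seq par c m t 1 0 j).2 :=
  add_pos_of_pos_of_nonneg (seq_pos ht j).1 (seq_pos ht j).2

theorem seq_eq (t x y : ℝ) (j : ℕ) :
    seq par c m t x y j =
      (x * (seq par c m t 1 0 j).1 + y * (seq par c m t 0 1 j).1,
        x * (seq par c m t 1 0 j).2 + y * (seq par c m t 0 1 j).2) := by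
  have := transfer_lin t 1 (fun i => load par c m t (c i)) x y 1 0 0 1 j
  simpa [seq] using this

variable (H : IsCycleWithPaths par c m)
include H

omit [Fintype V] in
theorem off_or_lt {x : V} (hx : ¬ (x = c m ∨ x = c (m + 1) ∨ x = c (m + 2))) :
    (∃ j < m, x = c j) ∨ IsOff c (m + 3) x := by
  rcases eq_or_isOff c (m + 3) x with ⟨i, hi, rfl⟩ | h
  · refine Or.inl ⟨i, ?_, rfl⟩
    by_contra hc
    rcases (by omega : i = m ∨ i = m + 1 ∨ i = m + 2) with rfl | rfl | rfl <;> simp at hx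
  · exact Or.inr h

omit [Fintype V] in
omit H in
theorem not_terminal_of_off {x : V} (hx : IsOff c (m + 3) x) :
    ¬ (x = c m ∨ x = c (m + 1) ∨ x = c (m + 2)) := by
  rintro (rfl | rfl | rfl)
  · exact not_isOff (by omega) hx
  · exact not_isOff (by omega) hx
  · exact not_isOff (by omega) hx

omit [Fintype V] in
theorem not_terminal_of_lt {j : ℕ} (hj : j < m) :
    ¬ (c j = c m ∨ c j = c (m + 1) ∨ c j = c (m + 2)) := by
  rintro (h | h | h)
  · have := H.inj _ (by omega) _ (by omega) h; omega
  · have := H.inj _ (by omega) _ (by omega) h; omega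
  · have := H.inj _ (by omega) _ (by omega) h; omega

open Classical in
/-- The vectors annihilated by the rows of `1 + t Q` outside of `c m, c (m + 1), c (m + 2)`. -/
theorem exists_harmonic {t : ℝ} (ht : 0 < t) (x y e : ℝ) :
    ∃ φ : V → ℝ,
      (∀ j ≤ m, φ (c j) =
        ((-t) ^ (j + 1))⁻¹ * ((seq par c m t x y j).1 + (seq par c m t x y j).2)) ∧
      φ (c (m + 1)) = e ∧ φ (c (m + 2)) = y / t ∧
      (∀ z, IsOff c (m + 3) z → φ z = -t / pivot par c m t z * φ (par z)) ∧
      ∀ i, ¬ (i = c m ∨ i = c (m + 1) ∨ i = c (m + 2)) →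
        ∑ z, Matrix.oneAddSmulLap t (parAdj par) i z * φ z = 0 := by
  obtain ⟨g, hg, -⟩ := exists_eq_on_cycle_and_off H.inj
    (fun j => if j ≤ m then
      ((-t) ^ (j + 1))⁻¹ * ((seq par c m t x y j).1 + (seq par c m t x y j).2)
      else if j = m + 1 then e else y / t) (fun _ => (0 : ℝ))
  obtain ⟨g₁, hg₁, hg₁'⟩ := exists_eq_on_cycle_and_off H.inj (fun j => g (c j))
    (fun z => -t / pivot par c m t z * g (par z))
  obtain ⟨φ, hφ, hφ'⟩ := exists_eq_on_cycle_and_off H.inj (fun j => g (c j))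
    (fun z => -t / pivot par c m t z * g₁ (par z))
  have e1 : ∀ j ≤ m, φ (c j) =
      ((-t) ^ (j + 1))⁻¹ * ((seq par c m t x y j).1 + (seq par c m t x y j).2) := by
    intro j hj
    rw [hφ j (by omega), hg j (by omega), if_pos hj]
  have e2 : φ (c (m + 1)) = e := by
    rw [hφ _ (by omega), hg _ (by omega), if_neg (by omega), if_pos rfl]
  have e3 : φ (c (m + 2)) = y / t := by
    rw [hφ _ (by omega), hg _ (by omega), if_neg (by omega), if_neg (by omega)]
  have e4 : ∀ z, IsOff c (m + 3) z → φ z = -t / pivot par c m t z * φ (par z) := by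
    intro z hz
    rw [hφ' z hz]
    rcases eq_or_isOff c (m + 3) (par z) with ⟨i, hi, h⟩ | h
    · rw [h, hφ i hi, hg₁ i hi]
    · rw [hφ' _ h, hg₁' _ h]
      rcases eq_or_isOff c (m + 3) (par (par z)) with ⟨i, hi, h'⟩ | h'
      · rw [h', hg₁ i hi]
      · exact absurd h' (H.par_par z hz h)
  refine ⟨φ, e1, e2, e3, e4, fun i hi => ?_⟩
  rw [Matrix.sum_oneAddSmulLap_mul]
  rcases H.off_or_lt hi with ⟨j, hj, rfl⟩ | h
  · rcases j with _ | j
    · have h0 := H.action_cycle e4 (i := m + 2) (by omega)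
      rw [show m + 2 + 1 = m + 3 from rfl, H.wrap, H.par_apply 0 (by omega), e3, e1 0 (by omega),
        e1 1 (by omega)] at h0
      rw [e1 0 (by omega), h0, seq_succ_fst_add_snd]
      have hy : (seq par c m t x y 0).2 = y := rfl
      have p1 : ((-t) ^ (0 + 1))⁻¹ = -(1 / t) := by
        rw [zero_add, pow_one, inv_neg, one_div]
      have p2 : ((-t) ^ (1 + 1))⁻¹ = 1 / t ^ 2 := by rw [neg_pow_two, one_div]
      rw [hy, zero_add 1, ← zero_add 1, p1, p2]
      field_simp
      ring
    · rw [H.action_cycle e4 (by omega), H.par_apply _ (by omega), e1 (j + 1) (by omega),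
        e1 j (by omega), e1 (j + 2) (by omega), seq_succ_fst_add_snd t x y (j + 1),
        seq_succ_snd]
      have hpow : (-t) ^ (j + 1) ≠ 0 := pow_ne_zero _ (by linarith)
      rw [pow_succ (-t) (j + 1 + 1), pow_succ (-t) (j + 1)]
      field_simp
      ring
  · exact H.harmonic_off ht e4 h

open Classical in
theorem sum_parAdj_filter {i : ℕ} (hi : i < m + 3) (F : V → ℝ) :
    ∑ z with ¬ (z = c m ∨ z = c (m + 1) ∨ z = c (m + 2)), parAdj par (c (i + 1)) z * F z =
      (if ¬ (par (c (i + 1)) = c m ∨ par (c (i + 1)) = c (m + 1) ∨ par (c (i + 1)) = c (m + 2))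
        then F (par (c (i + 1))) else 0) +
      ((if ¬ (c i = c m ∨ c i = c (m + 1) ∨ c i = c (m + 2)) then F (c i) else 0) +
        ∑ z ∈ branches par c m (c (i + 1)), F z) := by
  have h := H.sum_parAdj_mul (c (i + 1))
    (fun z => if ¬ (z = c m ∨ z = c (m + 1) ∨ z = c (m + 2)) then F z else 0)
  rw [H.sum_filter_par_cycle hi] at h
  rw [sum_filter]
  convert h using 1
  · exact sum_congr rfl fun z _ => by split_ifs <;> simp
  · congr 2
    exact sum_congr rfl fun z hz =>
      (if_pos (not_terminal_of_off (mem_branches.1 hz).1)).symm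

omit H in
theorem sum_branches_add {t : ℝ} {φ : V → ℝ}
    (hφ : ∀ z, IsOff c (m + 3) z → φ z = -t / pivot par c m t z * φ (par z)) {x : V} {e : ℝ}
    (he : φ x = e) :
    t * ∑ z ∈ branches par c m x, (e + φ z) = load par c m t x * e := by
  rw [sum_branches_harmonic hφ, he, sub_self, mul_zero, add_zero]

open Classical in
theorem sum_at_u {t : ℝ} {φ : V → ℝ}
    (hφ : ∀ z, IsOff c (m + 3) z → φ z = -t / pivot par c m t z * φ (par z))
    (hm : 0 < m) {e : ℝ} (he : φ (c m) = e) :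
    t * ∑ z with ¬ (z = c m ∨ z = c (m + 1) ∨ z = c (m + 2)), parAdj par (c m) z * (e + φ z) =
      t * (e + φ (c (m - 1))) + load par c m t (c m) * e := by
  obtain ⟨k, rfl⟩ : ∃ k, m = k + 1 := ⟨m - 1, by omega⟩
  rw [H.sum_parAdj_filter (by omega), H.par_apply _ (by omega), if_neg (by simp),
    if_pos (H.not_terminal_of_lt (by omega)), zero_add, mul_add, sum_branches_add hφ he,
    Nat.add_sub_cancel]

open Classical in
theorem sum_at_v {t : ℝ} {φ : V → ℝ}
    (hφ : ∀ z, IsOff c (m + 3) z → φ z = -t / pivot par c m t z * φ (par z))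
    {e : ℝ} (he : φ (c (m + 1)) = e) :
    t * ∑ z with ¬ (z = c m ∨ z = c (m + 1) ∨ z = c (m + 2)),
      parAdj par (c (m + 1)) z * (e + φ z) = load par c m t (c (m + 1)) * e := by
  rw [H.sum_parAdj_filter (by omega), H.par_apply _ (by omega), if_neg (by simp),
    if_neg (by simp), zero_add, zero_add, sum_branches_add hφ he]

open Classical in
theorem sum_at_w {t : ℝ} {φ : V → ℝ}
    (hφ : ∀ z, IsOff c (m + 3) z → φ z = -t / pivot par c m t z * φ (par z))
    (hm : 0 < m) {e : ℝ} (he : φ (c (m + 2)) = e) :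
    t * ∑ z with ¬ (z = c m ∨ z = c (m + 1) ∨ z = c (m + 2)),
      parAdj par (c (m + 2)) z * (e + φ z) =
      t * (e + φ (c 0)) + load par c m t (c (m + 2)) * e := by
  rw [H.sum_parAdj_filter (i := m + 1) (by omega), H.par_apply _ (by omega),
    show m + 1 + 1 + 1 = m + 3 from rfl, H.wrap,
    if_pos (H.not_terminal_of_lt hm), if_neg (by simp), zero_add, mul_add, sum_branches_add hφ he]

open Classical in
theorem filter_terminal_eq :
    (univ.filter fun z : V => ¬ (z = c m ∨ z = c (m + 1) ∨ z = c (m + 2))) =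
      (range m).image c ∪ univ.filter fun z => IsOff c (m + 3) z := by
  ext z
  simp only [mem_filter, mem_univ, true_and, mem_union, mem_image, mem_range]
  constructor
  · intro h
    rcases H.off_or_lt h with ⟨j, hj, rfl⟩ | h
    · exact Or.inl ⟨j, hj, rfl⟩
    · exact Or.inr h
  · rintro (⟨j, hj, rfl⟩ | h)
    · exact H.not_terminal_of_lt hj
    · exact not_terminal_of_off h

open Classical in
theorem det_block {t : ℝ} (ht : 0 < t) :
    (Matrix.toSquareBlockProp (Matrix.oneAddSmulLap t (parAdj par))
      fun i => ¬ (i = c m ∨ i = c (m + 1) ∨ i = c (m + 2))).det =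
      ((seq par c m t 1 0 m).1 + (seq par c m t 1 0 m).2) *
        ∏ z with IsOff c (m + 3) z, pivot par c m t z := by
  set K : ℕ → ℝ := fun j => (seq par c m t 1 0 j).1 + (seq par c m t 1 0 j).2 with hK
  have hKpos : ∀ j, 0 < K j := fun j => seq_sum_pos ht j
  obtain ⟨D, hDc, hDo⟩ := exists_eq_on_cycle_and_off H.inj (fun j => K (j + 1) / K j)
    (pivot par c m t)
  obtain ⟨ht', hht1, hht2⟩ := exists_eq_on_cycle_and_off H.inj (fun j => j + 2)
    (fun z => if IsOff c (m + 3) (par z) then 0 else 1)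
  have hdet := Matrix.det_forest (V := {i // ¬ (i = c m ∨ i = c (m + 1) ∨ i = c (m + 2))}) t
    (N := Matrix.toSquareBlockProp (Matrix.oneAddSmulLap t (parAdj par))
      fun i => ¬ (i = c m ∨ i = c (m + 1) ∨ i = c (m + 2)))
    (d := fun x => D x) (P := fun x y => par x.1 = y.1) (ht := fun x => ht' x)
    (fun x => by
      rcases H.off_or_lt x.2 with ⟨j, hj, h⟩ | h
      · rw [h, hDc j (by omega)]
        exact (div_pos (hKpos _) (hKpos _)).ne'
      · rw [hDo _ h]
        exact (pivot_pos ht _).ne')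
    (fun x y z h1 h2 => Subtype.ext (h1.symm.trans h2))
    (fun x y hxy => by
      rcases H.off_or_lt x.2 with ⟨j, hj, h⟩ | h
      · rw [h, H.par_apply j (by omega)] at hxy
        rw [h, ← hxy, hht1 j (by omega), hht1 (j + 1) (by omega)]
        omega
      · rw [hht2 _ h]
        rcases H.off_or_lt y.2 with ⟨j, hj, h'⟩ | h'
        · rw [h', hht1 j (by omega)]
          split_ifs <;> omega
        · have h1 := h'
          rw [← hxy] at h1
          rw [hht2 _ h', if_pos h1, ← hxy, if_neg (H.par_par _ h h1)]
          omega)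
    (fun x => by
      have hsub : ∑ y : {i // ¬ (i = c m ∨ i = c (m + 1) ∨ i = c (m + 2))} with par y.1 = x.1,
          t ^ 2 / D y.1 =
          ∑ y with par y = x.1 ∧ ¬ (y = c m ∨ y = c (m + 1) ∨ y = c (m + 2)), t ^ 2 / D y := by
        rw [sum_filter, sum_filter,
          ← sum_subtype (univ.filter fun i => ¬ (i = c m ∨ i = c (m + 1) ∨ i = c (m + 2)))
            (fun i => by simp) (fun i => if par i = x.1 then t ^ 2 / D i else 0), sum_filter]
        refine sum_congr rfl fun i _ => ?_
        split_ifs <;> tauto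
      have hrow : Matrix.toSquareBlockProp (Matrix.oneAddSmulLap t (parAdj par))
          (fun i => ¬ (i = c m ∨ i = c (m + 1) ∨ i = c (m + 2))) x x =
          1 + t * ∑ z, parAdj par x z * (1 : ℝ) := by
        have : parAdj par x.1 x.1 = 0 := by simp [parAdj, H.par_ne]
        simp [Matrix.toSquareBlockProp_def, Matrix.oneAddSmulLap, this]
      rw [hsub, hrow, H.sum_parAdj_mul]
      have hbr : ∀ x, ∑ z ∈ branches par c m x, t ^ 2 / D z =
          ∑ z ∈ branches par c m x, t ^ 2 / pivot par c m t z :=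
        fun x => sum_congr rfl fun z hz => by rw [hDo _ (mem_branches.1 hz).1]
      rcases H.off_or_lt x.2 with ⟨j, hj, h⟩ | h
      · have key : ∀ F : V → ℝ,
            ∑ y with par y = x.1 ∧ ¬ (y = c m ∨ y = c (m + 1) ∨ y = c (m + 2)), F y =
            ∑ y with par y = x.1, if ¬ (y = c m ∨ y = c (m + 1) ∨ y = c (m + 2)) then F y
              else 0 := by
          intro F
          rw [← filter_filter, sum_filter]
        have hbr' : ∑ z ∈ branches par c m (c j),
            (if ¬ (z = c m ∨ z = c (m + 1) ∨ z = c (m + 2)) then t ^ 2 / D z else 0) =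
            ∑ z ∈ branches par c m (c j), t ^ 2 / pivot par c m t z := by
          rw [← hbr]
          exact sum_congr rfl fun z hz => if_pos (not_terminal_of_off (mem_branches.1 hz).1)
        have hload : load par c m t (c j) = t * #(branches par c m (c j)) -
            ∑ z ∈ branches par c m (c j), t ^ 2 / pivot par c m t z := by
          rw [load, sum_sub_distrib, sum_const, nsmul_eq_mul, mul_comm]
        have hrec := seq_succ_fst_add_snd (par := par) (c := c) (m := m) t 1 0 j
        rw [key, h, hDc j (by omega)]
        rcases j with _ | j
        · have h0 := H.sum_filter_par_cycle (i := m + 2) (by omega)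
          rw [show m + 2 + 1 = m + 3 from rfl, H.wrap] at h0
          rw [h0, h0, if_neg (by simp), hbr', sum_const, nsmul_eq_mul]
          have hy : (seq par c m t 1 0 0).2 = 0 := rfl
          have hx : (seq par c m t 1 0 0).1 = 1 := rfl
          simp only [hK]
          rw [hrec, hload, hy, hx]
          ring
        · rw [H.sum_filter_par_cycle (by omega), H.sum_filter_par_cycle (by omega),
            if_pos (H.not_terminal_of_lt (by omega)), hbr', sum_const, nsmul_eq_mul,
            hDc j (by omega)]
          have hsnd : (seq par c m t 1 0 (j + 1)).2 = t * K j := seq_succ_snd t 1 0 j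
          rw [hload] at hrec
          change K (j + 1 + 1) = _ * K (j + 1) - t * (seq par c m t 1 0 (j + 1)).2 at hrec
          rw [hsnd] at hrec
          rw [hrec]
          have h1 := (hKpos j).ne'
          have h2 := (hKpos (j + 1)).ne'
          field_simp
          ring
      · have hfil : (univ.filter fun y => par y = x.1 ∧
            ¬ (y = c m ∨ y = c (m + 1) ∨ y = c (m + 2))) = branches par c m x.1 := by
          rw [← H.filter_par_eq_of_off h]
          refine filter_congr fun y _ => ⟨fun h => h.1, fun h' => ⟨h', ?_⟩⟩
          exact not_terminal_of_off (H.off_of_par_off (h'.symm ▸ h))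
        rw [hfil, hbr, hDo _ h, H.filter_par_eq_of_off h, ← H.one_add_card_branches ht h,
          sum_const, nsmul_eq_mul, mul_one])
    (fun x y hxy => by
      have hxy' : x.1 ≠ y.1 := fun h => hxy (Subtype.ext h)
      have h1 : ¬ (par x.1 = y.1 ∧ par y.1 = x.1) := by
        rintro ⟨h1, h2⟩
        exact H.par_par_ne x.1 (by rw [h1, h2])
      simp only [Matrix.toSquareBlockProp_def, Matrix.oneAddSmulLap, Matrix.of_apply, if_neg hxy',
        zero_add, parAdj]
      by_cases h2 : par x.1 = y.1 <;> by_cases h3 : par y.1 = x.1 <;> simp_all)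
  rw [hdet, ← prod_subtype (univ.filter fun i => ¬ (i = c m ∨ i = c (m + 1) ∨ i = c (m + 2)))
    (fun i => by simp) D, H.filter_terminal_eq, prod_union, prod_image]
  · congr 1
    · rw [prod_congr rfl fun j hj => hDc j (by have := mem_range.1 hj; omega)]
      change _ = K m
      generalize m = n
      induction n with
      | zero => simp [hK, seq, transfer]
      | succ n ih => rw [prod_range_succ, ih, mul_div_cancel₀ _ (hKpos n).ne']
    · exact prod_congr rfl fun z hz => hDo z (mem_filter.1 hz).2
  · intro i hi j hj h
    have h1 := mem_range.1 hi
    have h2 := mem_range.1 hj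
    exact H.inj i (by omega) j (by omega) h
  · rw [disjoint_left]
    rintro z hz hz'
    obtain ⟨j, hj, rfl⟩ := mem_image.1 hz
    have := mem_range.1 hj
    exact not_isOff (by omega) (mem_filter.1 hz').2

end Harmonic

end IsCycleWithPaths

namespace IsCycleWithPaths

section Count

variable {V : Type*} [Fintype V] {par : V → V} {c : ℕ → V} {m : ℕ} (H : IsCycleWithPaths par c m)
include H

open Classical in
@[to_additive]
theorem prod_off {M : Type*} [CommMonoid M] (F : V → M) :
    ∏ z with IsOff c (m + 3) z, F z =
      ∏ j ∈ range (m + 3), ∏ z ∈ branches par c m (c j),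
        (F z * ∏ y ∈ branches par c m z, F y) := by
  have h1 : ∏ z with IsOff c (m + 3) z, F z =
      (∏ z with IsOff c (m + 3) z ∧ ¬ IsOff c (m + 3) (par z), F z) *
        ∏ z with IsOff c (m + 3) z ∧ IsOff c (m + 3) (par z), F z := by
    rw [← prod_filter_mul_prod_filter_not _ (fun z => ¬ IsOff c (m + 3) (par z)), filter_filter,
      filter_filter]
    simp only [not_not]
  have h2 : ∏ z with IsOff c (m + 3) z ∧ IsOff c (m + 3) (par z), F z =
      ∏ z with IsOff c (m + 3) z ∧ ¬ IsOff c (m + 3) (par z), ∏ y ∈ branches par c m z, F y := by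
    rw [← prod_fiberwise_of_maps_to (g := par)
      (t := univ.filter fun z => IsOff c (m + 3) z ∧ ¬ IsOff c (m + 3) (par z))]
    · refine prod_congr rfl fun z hz => prod_congr ?_ fun _ _ => rfl
      have hz' := (mem_filter.1 hz).2
      ext y
      simp only [mem_filter, mem_univ, true_and, mem_branches]
      constructor
      · rintro ⟨⟨h, -⟩, h'⟩
        exact ⟨h, h'⟩
      · rintro ⟨h, rfl⟩
        exact ⟨⟨h, hz'.1⟩, rfl⟩
    · intro z hz
      have hz' := (mem_filter.1 hz).2
      simp only [mem_filter, mem_univ, true_and]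
      exact ⟨hz'.2, H.par_par z hz'.1 hz'.2⟩
  rw [h1, h2, ← prod_mul_distrib,
    ← prod_fiberwise_of_maps_to (g := par) (t := (range (m + 3)).image c), prod_image]
  · refine prod_congr rfl fun j hj => prod_congr ?_ fun _ _ => rfl
    ext z
    simp only [mem_filter, mem_univ, true_and, mem_branches]
    constructor
    · rintro ⟨⟨h, -⟩, h'⟩
      exact ⟨h, h'⟩
    · rintro ⟨h, h'⟩
      refine ⟨⟨h, ?_⟩, h'⟩
      rw [h']
      exact not_isOff (mem_range.1 hj)
  · intro i hi j hj h
    exact H.inj i (mem_range.1 hi) j (mem_range.1 hj) h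
  · intro z hz
    have hz' := (mem_filter.1 hz).2
    rcases eq_or_isOff c (m + 3) (par z) with ⟨i, hi, h⟩ | h
    · exact mem_image.2 ⟨i, mem_range.2 hi, h.symm⟩
    · exact absurd h hz'.2

/-- The number of pendent paths of length one at `x`. -/
noncomputable def shortCount (par : V → V) (c : ℕ → V) (m : ℕ) (x : V) : ℕ :=
  #((branches par c m x).filter fun z => #(branches par c m z) = 0)

/-- The number of pendent paths of length two at `x`. -/
noncomputable def longCount (par : V → V) (c : ℕ → V) (m : ℕ) (x : V) : ℕ :=
  #((branches par c m x).filter fun z => ¬ #(branches par c m z) = 0)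

omit H in
theorem pivot_eq (t : ℝ) (z : V) : pivot par c m t z =
    if #(branches par c m z) = 0 then 1 + t else (1 + 3 * t + t ^ 2) / (1 + t) := by
  by_cases h : branches par c m z = ∅ <;> simp [pivot, h]

theorem card_branches_eq_one {x : V} (hx : IsOff c (m + 3) x) (h : ¬ #(branches par c m x) = 0) :
    #(branches par c m x) = 1 := by
  have := H.card_branches_le_one hx
  omega

theorem card_eq :
    Fintype.card V = m + 3 +
      ∑ j ∈ range (m + 3), (shortCount par c m (c j) + 2 * longCount par c m (c j)) := by
  classical
  have h1 : Fintype.card V = #(univ.filter fun z => ¬ IsOff c (m + 3) z) +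
      #(univ.filter fun z => IsOff c (m + 3) z) := by
    rw [add_comm, card_filter_add_card_filter_not, card_univ]
  have h2 : (univ.filter fun z => ¬ IsOff c (m + 3) z) = (range (m + 3)).image c := by
    ext z
    simp only [mem_filter, mem_univ, true_and, mem_image, mem_range]
    constructor
    · intro h
      rcases eq_or_isOff c (m + 3) z with ⟨i, hi, h'⟩ | h'
      · exact ⟨i, hi, h'.symm⟩
      · exact absurd h' h
    · rintro ⟨i, hi, rfl⟩
      exact not_isOff hi
  rw [h1, h2, card_image_of_injOn, card_range, card_eq_sum_ones (univ.filter _), H.sum_off]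
  · congr 1
    refine sum_congr rfl fun j hj => ?_
    rw [← sum_filter_add_sum_filter_not (branches par c m (c j))
      (fun z => #(branches par c m z) = 0), shortCount, longCount, card_eq_sum_ones,
      card_eq_sum_ones, mul_sum]
    congr 1
    · refine sum_congr rfl fun z hz => ?_
      rw [← card_eq_sum_ones, (mem_filter.1 hz).2]
    · refine sum_congr rfl fun z hz => ?_
      have hz' := mem_filter.1 hz
      rw [← card_eq_sum_ones, H.card_branches_eq_one (mem_branches.1 hz'.1).1 hz'.2,
        mul_one]
  · intro i hi j hj h
    exact H.inj i (by simpa using hi) j (by simpa using hj) h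

theorem prod_pivot_eq {t : ℝ} (ht : 0 < t) (x : V) :
    ∏ z ∈ branches par c m x, (pivot par c m t z * ∏ y ∈ branches par c m z, pivot par c m t y) =
      (branchPoly (shortCount par c m x) (longCount par c m x)).eval t := by
  rw [← prod_filter_mul_prod_filter_not (branches par c m x)
    (fun z => #(branches par c m z) = 0)]
  have h1 : ∀ z ∈ (branches par c m x).filter (fun z => #(branches par c m z) = 0),
      pivot par c m t z * ∏ y ∈ branches par c m z, pivot par c m t y = 1 + t := by
    intro z hz
    have hz' := (mem_filter.1 hz).2
    rw [pivot_eq, if_pos hz', card_eq_zero.1 hz', prod_empty, mul_one]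
  have h2 : ∀ z ∈ (branches par c m x).filter (fun z => ¬ #(branches par c m z) = 0),
      pivot par c m t z * ∏ y ∈ branches par c m z, pivot par c m t y =
        1 + 3 * t + t ^ 2 := by
    intro z hz
    have hz' := mem_filter.1 hz
    have hoff := (mem_branches.1 hz'.1).1
    rw [pivot_eq, if_neg hz'.2, prod_congr rfl (g := fun _ => 1 + t), prod_const,
      H.card_branches_eq_one hoff hz'.2, pow_one, div_mul_cancel₀ _ (by positivity)]
    intro y hy
    refine H.pivot_of_par_off ?_
    rwa [(mem_branches.1 hy).2]
  rw [prod_congr rfl h1, prod_congr rfl h2, prod_const, prod_const]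
  simp [branchPoly, shortCount, longCount]

omit H in
theorem branchPoly_mul_load {t : ℝ} (ht : 0 < t) (x : V) :
    (branchPoly (shortCount par c m x) (longCount par c m x)).eval t * load par c m t x =
      (branchNum (shortCount par c m x) (longCount par c m x)).eval t := by
  have hload : load par c m t x = shortCount par c m x * (t / (1 + t)) +
      longCount par c m x * (t * (1 + 2 * t) / (1 + 3 * t + t ^ 2)) := by
    rw [load, ← sum_filter_add_sum_filter_not (branches par c m x)
      (fun z => #(branches par c m z) = 0), shortCount, longCount]
    congr 1
    · rw [← nsmul_eq_mul, ← sum_const]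
      refine sum_congr rfl fun z hz => ?_
      rw [pivot_eq, if_pos (mem_filter.1 hz).2]
      field_simp
      ring
    · rw [← nsmul_eq_mul, ← sum_const]
      refine sum_congr rfl fun z hz => ?_
      rw [pivot_eq, if_neg (mem_filter.1 hz).2]
      field_simp
      ring
  rw [hload]
  generalize shortCount par c m x = a
  generalize longCount par c m x = b
  have hpow : ∀ (y : ℝ) (n : ℕ), 0 < y → (n : ℝ) * y ^ (n - 1) = n * (y ^ n / y) := by
    intro y n hy
    rcases n with _ | n
    · simp
    · rw [Nat.add_sub_cancel, pow_succ, mul_div_cancel_right₀ _ hy.ne']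
  simp only [branchPoly, branchNum, eval_add, eval_mul, eval_pow, eval_one, eval_X, eval_natCast,
    eval_ofNat]
  rw [hpow _ _ (by positivity : 0 < 1 + t), hpow _ _ (by positivity : 0 < 1 + 3 * t + t ^ 2)]
  field_simp

end Count

section Difference

variable {V : Type*} [Fintype V] {par : V → V} {c : ℕ → V} {m : ℕ} (H : IsCycleWithPaths par c m)
include H

omit [Fintype V] H in
theorem parAdj_comm (x y : V) : parAdj par x y = parAdj par y x := by
  by_cases h1 : par x = y <;> by_cases h2 : par y = x <;> simp [parAdj, h1, h2]

open Classical in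
theorem det_sub_eq {t : ℝ} (ht : 0 < t) (hm : 0 < m) {a' : V → V → ℝ}
    (symm' : ∀ x y, a' x y = a' y x) (irr' : ∀ x, a' x x = 0)
    (hauv' : a' (c m) (c (m + 1)) = 1) (havw' : a' (c (m + 1)) (c (m + 2)) = 1)
    (hauw' : a' (c m) (c (m + 2)) = 0)
    (hu : ∀ x, ¬ (x = c m ∨ x = c (m + 1) ∨ x = c (m + 2)) →
      a' x (c m) = parAdj par x (c m) + parAdj par x (c (m + 1)) + parAdj par x (c (m + 2)))
    (hv : ∀ x, ¬ (x = c m ∨ x = c (m + 1) ∨ x = c (m + 2)) → a' x (c (m + 1)) = 0)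
    (hw : ∀ x, ¬ (x = c m ∨ x = c (m + 1) ∨ x = c (m + 2)) → a' x (c (m + 2)) = 0)
    (hS : ∀ x y, ¬ (x = c m ∨ x = c (m + 1) ∨ x = c (m + 2)) →
      ¬ (y = c m ∨ y = c (m + 1) ∨ y = c (m + 2)) → a' x y = parAdj par x y) :
    (Matrix.oneAddSmulLap t (parAdj par)).det - (Matrix.oneAddSmulLap t a').det =
      (branchDiff X (fun j => branchPoly (shortCount par c m (c j)) (longCount par c m (c j)))
        (fun j => branchNum (shortCount par c m (c j)) (longCount par c m (c j))) m).eval t := by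
  have hne : ∀ i < m + 3, ∀ j < m + 3, i ≠ j → c i ≠ c j :=
    fun i hi j hj hij h => hij (H.inj i hi j hj h)
  set α := (seq par c m t 1 0 m).1 with hα
  set β := (seq par c m t 1 0 m).2 with hβ
  set γ := (seq par c m t 0 1 m).1 with hγ
  set δ := (seq par c m t 0 1 m).2 with hδ
  have hA : 0 < α + β := seq_sum_pos ht m
  have hT : α * δ - β * γ = ((-t) ^ m) ^ 2 := by
    have := transfer_det t 1 (fun i => load par c m t (c i)) m
    simp only [Pi.one_apply, prod_const_one, mul_one] at this
    rw [← pow_mul, mul_comm m 2, pow_mul, neg_pow_two, ← pow_mul, mul_comm 2 m, pow_mul, ← this]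
    rfl
  have htm : (-t) ^ m ≠ 0 := pow_ne_zero _ (by linarith)
  obtain ⟨Ψu, u1, u2, u3, u4, u5⟩ := H.exists_harmonic ht ((-t) ^ (m + 1) / (α + β)) 0 0
  obtain ⟨Ψv, v1, v2, v3, v4, v5⟩ := H.exists_harmonic ht 0 0 1
  obtain ⟨Ψw, w1, w2, w3, w4, w5⟩ := H.exists_harmonic ht (-t * (γ + δ) / (α + β)) t 0
  have huu : Ψu (c m) = 1 := by
    rw [u1 m le_rfl, seq_eq, ← hα, ← hβ]
    have : (-t) ^ (m + 1) ≠ 0 := pow_ne_zero _ (by linarith)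
    field_simp
    ring
  have hvu : ∀ j ≤ m, Ψv (c j) = 0 := by
    intro j hj
    rw [v1 j hj, seq_eq]
    simp
  have hwu : Ψw (c m) = 0 := by
    rw [w1 m le_rfl, seq_eq, ← hα, ← hβ, ← hγ, ← hδ]
    field_simp
    ring
  rw [zero_div] at u3 v3
  rw [div_self ht.ne'] at w3
  have hβ' : β = t * ((seq par c m t 1 0 (m - 1)).1 + (seq par c m t 1 0 (m - 1)).2) := by
    rw [hβ, ← seq_succ_snd, Nat.sub_add_cancel hm]
  have hδ' : δ = t * ((seq par c m t 0 1 (m - 1)).1 + (seq par c m t 0 1 (m - 1)).2) := by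
    rw [hδ, ← seq_succ_snd, Nat.sub_add_cancel hm]
  have huk : Ψu (c (m - 1)) = -β / (α + β) := by
    rw [u1 _ (by omega), seq_eq, Nat.sub_add_cancel hm, hβ', pow_succ]
    field_simp
    ring
  have hwk : Ψw (c (m - 1)) = (-t) ^ m / (α + β) := by
    have h1 : Ψw (c (m - 1)) = ((-t) ^ m)⁻¹ * (-(γ + δ) / (α + β) * β + δ) := by
      rw [w1 _ (by omega), seq_eq, Nat.sub_add_cancel hm]
      linear_combination ((-t) ^ m)⁻¹ * ((γ + δ) / (α + β) * hβ' - hδ')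
    rw [h1, eq_div_iff hA.ne', inv_mul_eq_div, div_mul_eq_mul_div, div_eq_iff htm]
    field_simp
    linear_combination hT
  have hu0 : Ψu (c 0) = (-t) ^ m / (α + β) := by
    rw [u1 _ (by omega)]
    simp only [seq, transfer]
    rw [zero_add, pow_one, pow_succ]
    field_simp
    ring
  have hw0 : 1 + Ψw (c 0) = (γ + δ) / (α + β) := by
    rw [w1 _ (by omega)]
    simp only [seq, transfer]
    rw [zero_add, pow_one, inv_neg]
    field_simp
    ring
  have key := Matrix.det_oneAddSmulLap_sub t (a := parAdj par) (a' := a')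
    (hne m (by omega) (m + 1) (by omega) (by omega))
    (hne m (by omega) (m + 2) (by omega) (by omega))
    (hne (m + 1) (by omega) (m + 2) (by omega) (by omega)) parAdj_comm symm'
    (fun x => by simp [parAdj, H.par_ne]) irr'
    (if_pos (Or.inl (H.par_apply m (by omega))))
    (if_pos (Or.inl (H.par_apply (m + 1) (by omega))))
    (if_neg (by
      rw [H.par_apply m (by omega), H.par_apply (m + 2) (by omega), H.wrap]
      exact not_or.2 ⟨hne (m + 1) (by omega) (m + 2) (by omega) (by omega),
        hne 0 (by omega) m (by omega) (by omega)⟩))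
    hauv' havw' hauw' hu hv hw hS huu u2 u3 (hvu m le_rfl) v2 v3 hwu w2 w3 u5 v5 w5
    (x := t * α / (α + β) + load par c m t (c m)) (y := load par c m t (c (m + 1)))
    (z := t * (γ + δ) / (α + β) + load par c m t (c (m + 2))) (c := t * (-t) ^ m / (α + β))
    (by
      rw [H.sum_at_u u4 hm huu, huk]
      field_simp
      ring)
    (by rw [H.sum_at_v v4 v2, mul_one])
    (by
      rw [H.sum_at_w w4 hm w3, hw0]
      field_simp)
    (by
      have := H.sum_at_u w4 hm hwu
      simp only [zero_add] at this
      rw [this, hwk]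
      field_simp
      ring)
    (by
      have := H.sum_at_w u4 hm u3
      simp only [zero_add] at this
      rw [this, hu0]
      field_simp
      ring)
    (by
      have := H.sum_at_u v4 hm (hvu m le_rfl)
      simp only [zero_add] at this
      rw [this, hvu _ (by omega)]
      ring)
    (by simpa using H.sum_at_v u4 u2)
    (by simpa using H.sum_at_v w4 w2)
    (by
      have := H.sum_at_w v4 hm v3
      simp only [zero_add] at this
      rw [this, hvu _ (by omega)]
      ring)
  rw [key, H.det_block ht, H.prod_off, prod_congr rfl fun j _ => H.prod_pivot_eq ht (c j),
    ← coe_evalRingHom, ← branchDiff_map]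
  simp only [coe_evalRingHom, eval_X, ← branchPoly_mul_load ht, branchDiff, transfer_homogeneous]
  simp only [prod_range_succ]
  change (α + β) * _ * _ = _
  generalize ∏ j ∈ range m,
    (branchPoly (shortCount par c m (c j)) (longCount par c m (c j))).eval t = P
  have e1 : (transfer t 1 (fun i => load par c m t (c i)) 1 0 m).1 = α := rfl
  have e2 : (transfer t 1 (fun i => load par c m t (c i)) 1 0 m).2 = β := rfl
  have e3 : (transfer t 1 (fun i => load par c m t (c i)) 0 1 m).1 = γ := rfl
  have e4 : (transfer t 1 (fun i => load par c m t (c i)) 0 1 m).2 = δ := rfl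
  rw [e1, e2, e3, e4]
  have hsign : 2 * (-1) ^ m * (1 + 3 * t) * t ^ (m + 1) = 2 * (1 + 3 * t) * (t * (-t) ^ m) := by
    rw [neg_pow t, pow_succ]; ring
  rw [hsign]
  generalize load par c m t (c m) = lu
  generalize load par c m t (c (m + 1)) = lv
  generalize load par c m t (c (m + 2)) = lw
  generalize (-t) ^ m = T at *
  have hxz : (α + β) * ((t * α / (α + β) + lu) * (t * (γ + δ) / (α + β) + lw) -
      (t * T / (α + β)) ^ 2) =
      (α + β) * lu * lw + t * lu * (γ + δ) + t * lw * α + t ^ 2 * γ := by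
    field_simp
    linear_combination t ^ 2 * hT
  have hx : (α + β) * (t * α / (α + β)) = t * α := by field_simp
  have hz : (α + β) * (t * (γ + δ) / (α + β)) = t * (γ + δ) := by field_simp
  have hc : (α + β) * (t * T / (α + β)) = t * T := by field_simp
  generalize t * α / (α + β) = x' at *
  generalize t * (γ + δ) / (α + β) = z' at *
  generalize t * T / (α + β) = c' at *
  generalize (branchPoly (shortCount par c m (c m)) (longCount par c m (c m))).eval t = pu
  generalize (branchPoly (shortCount par c m (c (m + 1))) (longCount par c m (c (m + 1)))).eval t
    = pv
  generalize (branchPoly (shortCount par c m (c (m + 2))) (longCount par c m (c (m + 2)))).eval t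
    = pw
  linear_combination (P * pu * pv * pw) * ((lv + 1 + 2 * t) * hxz + lv * (1 + t) * (hx + hz) -
    2 * (1 + 3 * t) * hc)

end Difference

end IsCycleWithPaths

namespace SimpleGraph

section Coefficients

variable {V : Type*} [Fintype V] (G : SimpleGraph V)

open Classical in
/-- The adjacency matrix as a real function. -/
noncomputable def adjFun (x y : V) : ℝ := if G.Adj x y then 1 else 0

variable {G} in
omit [Fintype V] in
theorem adjFun_eq_one {x y : V} (h : G.Adj x y) : G.adjFun x y = 1 := if_pos h

variable {G} in
omit [Fintype V] in
theorem adjFun_eq_zero {x y : V} (h : ¬ G.Adj x y) : G.adjFun x y = 0 := if_neg h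

variable {G} in
omit [Fintype V] in
theorem adjFun_congr {G' : SimpleGraph V} {x y x' y' : V} (h : G.Adj x y ↔ G'.Adj x' y') :
    G.adjFun x y = G'.adjFun x' y' := by
  by_cases h' : G.Adj x y
  · rw [adjFun_eq_one h', adjFun_eq_one (h.1 h')]
  · rw [adjFun_eq_zero h', adjFun_eq_zero (mt h.2 h')]

omit [Fintype V] in
theorem adjFun_comm (x y : V) : G.adjFun x y = G.adjFun y x := adjFun_congr (G.adj_comm x y)

open Classical in
/-- The generating polynomial `det (1 + X Q(G))` of the signless Laplacian coefficients. -/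
noncomputable def signlessLapPoly : ℝ[X] := G.signlessLapMatrix.charpolyRev.comp (C (-1) * X)

open Classical in
theorem coeff_signlessLapPoly {i : ℕ} (hi : i ≤ Fintype.card V) :
    G.signlessLapPoly.coeff i = G.signlessLapCoeff i := by
  rw [signlessLapPoly, signlessLapCoeff, ← Matrix.reverse_charpoly, comp_C_mul_X_coeff,
    coeff_reverse, Matrix.charpoly_natDegree_eq_dim, revAt_le hi, mul_comm]

open Classical in
theorem eval_signlessLapPoly (t : ℝ) :
    G.signlessLapPoly.eval t = (Matrix.oneAddSmulLap t G.adjFun).det := by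
  rw [signlessLapPoly, eval_comp, Matrix.charpolyRev, ← coe_evalRingHom, RingHom.map_det]
  congr 1
  ext x y
  have hdeg : (G.degree x : ℝ) = ∑ z, G.adjFun x z := by
    simp only [adjFun]
    rw [← card_neighborFinset_eq_degree, neighborFinset_eq_filter]
    simp
  by_cases hxy : x = y
  · subst hxy
    simp [Matrix.oneAddSmulLap, signlessLapMatrix, degMatrix, adjFun, hdeg]
  · by_cases h : G.Adj x y <;>
      simp [Matrix.oneAddSmulLap, signlessLapMatrix, degMatrix, adjFun, hxy, h]

variable {G}

omit [Fintype V] in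
theorem moveBranches_adj {u v w : V} {x y : V} :
    (G.moveBranches u v w).Adj x y ↔
      (G.Adj x y ∧ ¬ (x = w ∧ y ≠ v) ∧ ¬ (y = w ∧ x ≠ v) ∧ ¬ (x = v ∧ y ≠ u ∧ y ≠ w) ∧
          ¬ (y = v ∧ x ≠ u ∧ x ≠ w)) ∨
        (x ≠ y ∧ ((x = u ∧ (G.Adj w y ∧ y ≠ v ∨ G.Adj v y ∧ y ≠ u ∧ y ≠ w)) ∨
          (y = u ∧ (G.Adj w x ∧ x ≠ v ∨ G.Adj v x ∧ x ≠ u ∧ x ≠ w)))) := by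
  have h1 : ∀ a b : V, ∀ T : Set V, s(x, y) ∈ {e | ∃ z ∈ T, e = s(a, z)} ↔
      (x = a ∧ y ∈ T) ∨ (y = a ∧ x ∈ T) := by
    intro a b T
    simp only [Set.mem_ofPred_eq, Sym2.eq_iff]
    constructor
    · rintro ⟨z, hz, ⟨rfl, rfl⟩ | ⟨rfl, rfl⟩⟩
      · exact Or.inl ⟨rfl, hz⟩
      · exact Or.inr ⟨rfl, hz⟩
    · rintro (⟨rfl, hz⟩ | ⟨rfl, hz⟩)
      · exact ⟨_, hz, Or.inl ⟨rfl, rfl⟩⟩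
      · exact ⟨_, hz, Or.inr ⟨rfl, rfl⟩⟩
  simp only [moveBranches, sup_adj, deleteEdges_adj, fromEdgeSet_adj, Set.mem_union, h1 _ u]
  simp only [Set.mem_sdiff, mem_neighborSet, Set.mem_insert_iff, Set.mem_singleton_iff, ne_eq]
  constructor
  · rintro (⟨h, h'⟩ | ⟨h, h'⟩)
    · refine Or.inl ⟨h, ?_, ?_, ?_, ?_⟩
      · rintro ⟨rfl, h2⟩; exact h' (Or.inl (Or.inl ⟨rfl, h, h2⟩))
      · rintro ⟨rfl, h2⟩; exact h' (Or.inl (Or.inr ⟨rfl, h.symm, h2⟩))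
      · rintro ⟨rfl, h2, h3⟩; exact h' (Or.inr (Or.inl ⟨rfl, h, by tauto⟩))
      · rintro ⟨rfl, h2, h3⟩; exact h' (Or.inr (Or.inr ⟨rfl, h.symm, by tauto⟩))
    · refine Or.inr ⟨h', ?_⟩
      rcases h with (⟨e, h1, h2⟩ | ⟨e, h1, h2⟩) | ⟨e, h1, h2⟩ | ⟨e, h1, h2⟩
      · exact Or.inl ⟨e, Or.inl ⟨h1, h2⟩⟩
      · exact Or.inr ⟨e, Or.inl ⟨h1, h2⟩⟩
      · exact Or.inl ⟨e, Or.inr ⟨h1, not_or.1 h2⟩⟩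
      · exact Or.inr ⟨e, Or.inr ⟨h1, not_or.1 h2⟩⟩
  · rintro (⟨h, a1, a2, a3, a4⟩ | ⟨h, h2⟩)
    · refine Or.inl ⟨h, ?_⟩
      rintro ((⟨e, -, h2⟩ | ⟨e, -, h2⟩) | ⟨e, -, h2⟩ | ⟨e, -, h2⟩)
      · exact a1 ⟨e, h2⟩
      · exact a2 ⟨e, h2⟩
      · exact a3 ⟨e, not_or.1 h2⟩
      · exact a4 ⟨e, not_or.1 h2⟩
    · refine Or.inr ⟨?_, h⟩
      rcases h2 with ⟨e, ⟨h1, h2⟩ | ⟨h1, h2⟩⟩ | ⟨e, ⟨h1, h2⟩ | ⟨h1, h2⟩⟩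
      · exact Or.inl (Or.inl ⟨e, h1, h2⟩)
      · exact Or.inr (Or.inl ⟨e, h1, not_or.2 h2⟩)
      · exact Or.inl (Or.inr ⟨e, h1, h2⟩)
      · exact Or.inr (Or.inr ⟨e, h1, not_or.2 h2⟩)

end Coefficients

section Main

open IsCycleWithPaths

variable {V : Type*} [Fintype V] {G : SimpleGraph V} {par : V → V} {c : ℕ → V} {m : ℕ}

theorem signlessLapPoly_sub (H : IsCycleWithPaths par c m) (hm : 2 ≤ m)
    (hadj : ∀ x y, G.Adj x y ↔ par x = y ∨ par y = x) :
    G.signlessLapPoly - (G.moveBranches (c m) (c (m + 1)) (c (m + 2))).signlessLapPoly =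
      branchDiff X (fun j => branchPoly (shortCount par c m (c j)) (longCount par c m (c j)))
        (fun j => branchNum (shortCount par c m (c j)) (longCount par c m (c j))) m := by
  have hne : ∀ i < m + 3, ∀ j < m + 3, i ≠ j → c i ≠ c j :=
    fun i hi j hj hij h => hij (H.inj i hi j hj h)
  have huv := hne m (by omega) (m + 1) (by omega) (by omega)
  have huw := hne m (by omega) (m + 2) (by omega) (by omega)
  have hvw := hne (m + 1) (by omega) (m + 2) (by omega) (by omega)
  have pu : par (c m) = c (m + 1) := H.par_apply m (by omega)
  have pv : par (c (m + 1)) = c (m + 2) := H.par_apply (m + 1) (by omega)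
  have pw : par (c (m + 2)) = c 0 := by rw [H.par_apply (m + 2) (by omega), H.wrap]
  have auv : G.Adj (c m) (c (m + 1)) := (hadj _ _).2 (Or.inl pu)
  have avw : G.Adj (c (m + 1)) (c (m + 2)) := (hadj _ _).2 (Or.inl pv)
  have auw : ¬ G.Adj (c m) (c (m + 2)) := by
    rw [hadj, pu, pw]
    exact not_or.2 ⟨hvw, hne 0 (by omega) m (by omega) (by omega)⟩
  have hfun : G.adjFun = parAdj par := by
    ext x y
    rw [parAdj]
    split_ifs with h
    · exact adjFun_eq_one ((hadj x y).2 h)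
    · exact adjFun_eq_zero (mt (hadj x y).1 h)
  have e1 : ∀ x, ¬ (x = c m ∨ x = c (m + 1) ∨ x = c (m + 2)) →
      (G.Adj x (c m) ↔ par x = c m) := by
    intro x hx
    rw [hadj, pu]
    exact or_iff_left fun h => hx (Or.inr (Or.inl h.symm))
  have e2 : ∀ x, ¬ (x = c m ∨ x = c (m + 1) ∨ x = c (m + 2)) →
      (G.Adj x (c (m + 1)) ↔ par x = c (m + 1)) := by
    intro x hx
    rw [hadj, pv]
    exact or_iff_left fun h => hx (Or.inr (Or.inr h.symm))
  have e3 : ∀ x, G.Adj x (c (m + 2)) → par x = c (m + 2) ∨ par x = c 1 := by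
    intro x h
    rw [hadj, pw] at h
    rcases h with h | rfl
    · exact Or.inl h
    · exact Or.inr (H.par_apply 0 (by omega))
  have h1u := hne 1 (by omega) m (by omega) (by omega)
  have h1v := hne 1 (by omega) (m + 1) (by omega) (by omega)
  have hG' := fun x y =>
    moveBranches_adj (G := G) (u := c m) (v := c (m + 1)) (w := c (m + 2)) (x := x) (y := y)
  generalize G.moveBranches (c m) (c (m + 1)) (c (m + 2)) = G' at hG' ⊢
  refine eq_of_infinite_eval_eq _ _ ((Set.Ioi_infinite (0 : ℝ)).mono fun t ht => ?_)
  rw [Set.mem_ofPred_eq, eval_sub, eval_signlessLapPoly, eval_signlessLapPoly, hfun,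
    H.det_sub_eq (a' := G'.adjFun) ht (by omega) G'.adjFun_comm (fun x => by simp [adjFun])]
  · exact adjFun_eq_one ((hG' _ _).2 (Or.inl ⟨auv, by simp [huw], by simp [hvw], by simp [huv],
      by simp⟩))
  · exact adjFun_eq_one ((hG' _ _).2 (Or.inl ⟨avw, by simp [hvw], by simp, by simp,
      by simp [hvw.symm]⟩))
  · refine adjFun_eq_zero fun h => ?_
    rcases (hG' _ _).1 h with h | ⟨-, h | h⟩
    · exact auw h.1
    · rcases h.2 with h | h
      · exact G.loopless.irrefl _ h.1
      · exact h.2.2 rfl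
    · exact huw h.1.symm
  · intro x hx
    have hx' := hx
    rw [not_or, not_or] at hx
    obtain ⟨x1, x2, x3⟩ := hx
    have hiff : G'.Adj x (c m) ↔ G.Adj x (c m) ∨ G.Adj x (c (m + 1)) ∨ G.Adj x (c (m + 2)) := by
      rw [hG', G.adj_comm (c (m + 2)) x, G.adj_comm (c (m + 1)) x]
      simp only [x1, x2, x3, huv, huw, false_and, not_false_eq_true, and_true, ne_eq, false_or,
        true_and]
      tauto
    rw [← hfun]
    have n1 : G.Adj x (c m) → ¬ G.Adj x (c (m + 1)) := by
      rw [e1 x hx', e2 x hx']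
      intro h h'
      exact huv (h.symm.trans h')
    have n2 : G.Adj x (c m) → ¬ G.Adj x (c (m + 2)) := by
      rw [e1 x hx']
      intro h h'
      rcases e3 x h' with h' | h'
      · exact huw (h.symm.trans h')
      · exact h1u (h'.symm.trans h)
    have n3 : G.Adj x (c (m + 1)) → ¬ G.Adj x (c (m + 2)) := by
      rw [e2 x hx']
      intro h h'
      rcases e3 x h' with h' | h'
      · exact hvw (h.symm.trans h')
      · exact h1v (h'.symm.trans h)
    by_cases a1 : G.Adj x (c m)
    · rw [adjFun_eq_one (hiff.2 (Or.inl a1)), adjFun_eq_one a1, adjFun_eq_zero (n1 a1),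
        adjFun_eq_zero (n2 a1), add_zero, add_zero]
    · by_cases a2 : G.Adj x (c (m + 1))
      · rw [adjFun_eq_one (hiff.2 (Or.inr (Or.inl a2))), adjFun_eq_zero a1, adjFun_eq_one a2,
          adjFun_eq_zero (n3 a2), add_zero, zero_add]
      · rw [adjFun_eq_zero a1, adjFun_eq_zero a2, add_zero, zero_add]
        exact adjFun_congr (by simp [hiff, a1, a2])
  · intro x hx
    rw [not_or, not_or] at hx
    refine adjFun_eq_zero fun h => ?_
    rcases (hG' _ _).1 h with h | ⟨-, h | h⟩
    · exact h.2.2.2.2 ⟨rfl, hx.1, hx.2.2⟩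
    · exact hx.1 h.1
    · exact huv h.1.symm
  · intro x hx
    rw [not_or, not_or] at hx
    refine adjFun_eq_zero fun h => ?_
    rcases (hG' _ _).1 h with h | ⟨-, h | h⟩
    · exact h.2.2.1 ⟨rfl, hx.2.1⟩
    · exact hx.1 h.1
    · exact huw h.1.symm
  · intro x y hx hy
    rw [not_or, not_or] at hx hy
    rw [← hfun]
    have : G'.Adj x y ↔ G.Adj x y := by
      rw [hG']
      simp [hx, hy]
    exact adjFun_congr this

theorem signlessLapCoeff_moveBranches_of_par (H : IsCycleWithPaths par c m) (hm : 2 ≤ m)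
    (hadj : ∀ x y, G.Adj x y ↔ par x = y ∨ par y = x) (hn : 6 ≤ Fintype.card V) {i : ℕ}
    (hi : i ≤ Fintype.card V) :
    (G.moveBranches (c m) (c (m + 1)) (c (m + 2))).signlessLapCoeff i ≤ G.signlessLapCoeff i ∧
      (G.signlessLapCoeff i =
          (G.moveBranches (c m) (c (m + 1)) (c (m + 2))).signlessLapCoeff i ↔
        i = 0 ∨ i = 1 ∨ i = Fintype.card V ∨ (Fintype.card V = 6 ∧ m = 2 ∧ i = 5)) := by
  have hD := congrArg (fun p => p.coeff i) (signlessLapPoly_sub H hm hadj)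
  simp only [coeff_sub, coeff_signlessLapPoly _ hi] at hD
  set D := branchDiff X (fun j => branchPoly (shortCount par c m (c j)) (longCount par c m (c j)))
        (fun j => branchNum (shortCount par c m (c j)) (longCount par c m (c j))) m with hDdef
  have hcard := H.card_eq
  have hmain : ∀ {a b : ℕ}, PosOn a b D →
      (G.moveBranches (c m) (c (m + 1)) (c (m + 2))).signlessLapCoeff i ≤ G.signlessLapCoeff i ∧
      (G.signlessLapCoeff i =
        (G.moveBranches (c m) (c (m + 1)) (c (m + 2))).signlessLapCoeff i ↔
          ¬ (a ≤ i ∧ i ≤ b)) := by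
    intro a b h
    have h0 := (h.nonnegOn i).1
    refine ⟨by linarith, fun heq hab => ?_, fun hab => ?_⟩
    · have := (h i).1 hab
      linarith
    · have := (h i).2 hab
      linarith
  rcases Nat.lt_or_ge 2 m with hm3 | hm3
  · have := hmain (posOn_branchDiff_of_three_le (show 3 ≤ m from hm3) _ _)
    refine ⟨this.1, this.2.trans ?_⟩
    omega
  · obtain rfl : m = 2 := by omega
    rcases Nat.lt_or_ge (∑ j ∈ range 5, (shortCount par c 2 (c j) + 2 * longCount par c 2 (c j))) 2
      with h | h
    · have := hmain (posOn_branchDiff_two_of_eq_one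
        (A := fun j => shortCount par c 2 (c j)) (B := fun j => longCount par c 2 (c j))
        (by simp only [Nat.reduceAdd] at hcard; omega))
      refine ⟨this.1, this.2.trans ?_⟩
      simp only [Nat.reduceAdd] at hcard
      omega
    · have := hmain (posOn_branchDiff_two
        (A := fun j => shortCount par c 2 (c j)) (B := fun j => longCount par c 2 (c j)) h)
      refine ⟨this.1, this.2.trans ?_⟩
      simp only [Nat.reduceAdd] at hcard
      omega

end Main

end SimpleGraph

namespace SimpleGraph

section Extract

variable {V : Type*} {G : SimpleGraph V}

theorem OnCycle.of_mem_support {x y : V} {p : G.Walk x x} (hp : p.IsCycle) (hy : y ∈ p.support) :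
    G.OnCycle y := by
  classical
  exact ⟨p.rotate y hy, (Walk.isCycle_rotate hy).2 hp⟩

theorem Walk.IsCycle.exists_two_adj {x y : V} {p : G.Walk x x} (hp : p.IsCycle)
    (hy : y ∈ p.support) :
    ∃ a b, a ≠ b ∧ G.Adj y a ∧ G.Adj y b ∧ a ∈ p.support ∧ b ∈ p.support := by
  classical
  have hq := (Walk.isCycle_rotate hy).2 hp
  refine ⟨(p.rotate y hy).snd, (p.rotate y hy).penultimate, hq.snd_ne_penultimate,
    Walk.adj_snd hq.not_nil, (Walk.adj_penultimate hq.not_nil).symm, ?_, ?_⟩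
  · exact (Walk.mem_support_rotate_iff p y hy).1 (Walk.getVert_mem_support _ _)
  · exact (Walk.mem_support_rotate_iff p y hy).1 (Walk.getVert_mem_support _ _)

theorem OnCycle.exists_two_adj {x : V} (hx : G.OnCycle x) :
    ∃ a b, a ≠ b ∧ G.Adj x a ∧ G.Adj x b ∧ G.OnCycle a ∧ G.OnCycle b := by
  obtain ⟨p, hp⟩ := hx
  obtain ⟨a, b, h, ha, hb, ha', hb'⟩ := hp.exists_two_adj p.start_mem_support
  exact ⟨a, b, h, ha, hb, OnCycle.of_mem_support hp ha', OnCycle.of_mem_support hp hb'⟩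

variable [Fintype V]

open Classical in
theorem adj_iff_of_degree_eq_one {x a : V} (h : G.degree x = 1) (ha : G.Adj x a) (z : V) :
    G.Adj x z ↔ z = a := by
  obtain ⟨b, hb, hb'⟩ := degree_eq_one_iff_existsUnique_adj.1 h
  constructor
  · intro hz
    rw [hb' z hz, hb' a ha]
  · rintro rfl
    exact ha

open Classical in
theorem adj_iff_of_degree_eq_two {x a b : V} (h : G.degree x = 2) (ha : G.Adj x a)
    (hb : G.Adj x b) (hab : a ≠ b) (z : V) : G.Adj x z ↔ z = a ∨ z = b := by
  have : ({a, b} : Finset V) = G.neighborFinset x := by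
    refine eq_of_subset_of_card_le ?_ ?_
    · intro z hz
      rw [mem_neighborFinset]
      rcases mem_insert.1 hz with rfl | hz
      · exact ha
      · rwa [mem_singleton.1 hz]
    · rw [card_neighborFinset_eq_degree, h, card_pair hab]
  rw [← mem_neighborFinset, ← this]
  simp

/-- The vertices off the cycle are leaves at the cycle, or the inner or the outer vertex of a
pendent path of length two. -/
theorem OnlyPendentPathsOnCycle.classify (hpend : G.OnlyPendentPathsOnCycle 2) {x : V}
    (hx : ¬ G.OnCycle x) :
    (∃ a, G.OnCycle a ∧ ∀ z, G.Adj x z ↔ z = a) ∨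
    (∃ a y, G.OnCycle a ∧ ¬ G.OnCycle y ∧ (∀ z, G.Adj x z ↔ z = a ∨ z = y) ∧
      ∀ z, G.Adj y z ↔ z = x) ∨
    (∃ a y, G.OnCycle a ∧ ¬ G.OnCycle y ∧ (∀ z, G.Adj x z ↔ z = y) ∧
      ∀ z, G.Adj y z ↔ z = a ∨ z = x) := by
  classical
  obtain ⟨a, b, p, ha, ⟨-, hlen, -, hdeg, hint⟩, hle, hxp⟩ := hpend x hx
  match p, hlen, hle, hint, hxp with
  | .nil, hlen, _, _, _ => simp at hlen
  | .cons h .nil, _, _, _, hxp =>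
    simp only [Walk.support_cons, Walk.support_nil, List.mem_cons, List.not_mem_nil,
      or_false] at hxp
    rcases hxp with rfl | rfl
    · exact absurd ha hx
    · refine Or.inl ⟨a, ha, adj_iff_of_degree_eq_one ?_ h.symm⟩
      convert hdeg
  | .cons (v := y) h (.cons h' .nil), _, _, hint, hxp =>
    have hb := adj_iff_of_degree_eq_one (by convert hdeg) h'.symm
    have hb' : ¬ G.OnCycle b := by
      intro hb0
      obtain ⟨c, d, hcd, hc, hd, -, -⟩ := hb0.exists_two_adj
      exact hcd (((hb c).1 hc).trans ((hb d).1 hd).symm)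
    have hab : a ≠ b := fun e => hb' (e ▸ ha)
    have hdeg' : G.degree y = 2 := hint 1 (by simp) (by simp)
    have hy := adj_iff_of_degree_eq_two (by convert hdeg') h.symm h' hab
    have hy' : ¬ G.OnCycle y := by
      intro hy0
      obtain ⟨c, d, hcd, hc, hd, hc', hd'⟩ := hy0.exists_two_adj
      rcases (hy c).1 hc with rfl | rfl
      · rcases (hy d).1 hd with rfl | rfl
        · exact hcd rfl
        · exact hb' hd'
      · exact hb' hc'
    simp only [Walk.support_cons, Walk.support_nil, List.mem_cons, List.not_mem_nil,
      or_false] at hxp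
    rcases hxp with rfl | rfl | rfl
    · exact absurd ha hx
    · exact Or.inr (Or.inl ⟨a, b, ha, hb', hy, hb⟩)
    · exact Or.inr (Or.inr ⟨a, y, ha, hy', hb, hy⟩)
  | .cons _ (.cons _ (.cons _ q)), _, hle, _, _ =>
    simp only [Walk.length_cons] at hle
    omega

/-- Parents of the vertices off the cycle. -/
theorem OnlyPendentPathsOnCycle.exists_parent (hpend : G.OnlyPendentPathsOnCycle 2) :
    ∃ par : V → V, ∀ x, ¬ G.OnCycle x →
      G.Adj x (par x) ∧
      (∀ z, G.Adj x z → z = par x ∨ (¬ G.OnCycle z ∧ par z = x)) ∧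
      (¬ G.OnCycle (par x) → G.OnCycle (par (par x))) ∧
      (¬ G.OnCycle (par x) → ∀ y, ¬ G.OnCycle y → par y ≠ x) ∧
      (∀ y z, ¬ G.OnCycle y → ¬ G.OnCycle z → par y = x → par z = x → y = z) := by
  have hex : ∀ x, ∃ y, ¬ G.OnCycle x → G.Adj x y ∧ (G.OnCycle y ∨ ∀ z, G.Adj x z ↔ z = y) := by
    intro x
    by_cases hx : G.OnCycle x
    · exact ⟨x, fun h => absurd hx h⟩
    · rcases hpend.classify hx with ⟨a, ha, h⟩ | ⟨a, y, ha, hy, h, h'⟩ | ⟨a, y, ha, hy, h, h'⟩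
      · exact ⟨a, fun _ => ⟨(h a).2 rfl, Or.inl ha⟩⟩
      · exact ⟨a, fun _ => ⟨(h a).2 (Or.inl rfl), Or.inl ha⟩⟩
      · exact ⟨y, fun _ => ⟨(h y).2 rfl, Or.inr h⟩⟩
  choose par hpar using hex
  have huniq : ∀ x y, ¬ G.OnCycle x → G.Adj x y → (G.OnCycle y ∨ ∀ z, G.Adj x z ↔ z = y) →
      par x = y := by
    intro x y hx hxy hy
    obtain ⟨h1, h2⟩ := hpar x hx
    rcases hy with hy | hy
    · rcases h2 with h2 | h2
      · rcases hpend.classify hx with ⟨a, ha, h⟩ | ⟨a, y', ha, hy', h, h'⟩ | ⟨a, y', ha, hy', h, h'⟩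
        · rw [(h _).1 h1, (h _).1 hxy]
        · rcases (h _).1 h1 with e1 | e1
          · rcases (h _).1 hxy with e2 | e2
            · rw [e1, e2]
            · exact absurd hy (e2 ▸ hy')
          · exact absurd h2 (e1 ▸ hy')
        · rw [(h _).1 h1, (h _).1 hxy]
      · exact ((h2 y).1 hxy).symm
    · exact (hy _).1 h1
  refine ⟨par, fun x hx => ⟨(hpar x hx).1, ?_⟩⟩
  rcases hpend.classify hx with ⟨a, ha, h⟩ | ⟨a, y, ha, hy, h, h'⟩ | ⟨a, y, ha, hy, h, h'⟩
  · have e := huniq x a hx ((h a).2 rfl) (Or.inl ha)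
    have hno : ∀ z, ¬ G.OnCycle z → par z ≠ x := by
      intro z hz e'
      have := (hpar z hz).1
      rw [e'] at this
      exact hz ((h z).1 this.symm ▸ ha)
    exact ⟨fun z hz => Or.inl (((h z).1 hz).trans e.symm), fun h0 => absurd (e ▸ ha) h0,
      fun h0 => absurd (e ▸ ha) h0, fun y z hy _ hy' => absurd hy' (hno y hy)⟩
  · have e := huniq x a hx ((h a).2 (Or.inl rfl)) (Or.inl ha)
    have ey := huniq y x hy ((h' x).2 rfl) (Or.inr h')
    have hch : ∀ z, ¬ G.OnCycle z → par z = x → z = y := by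
      intro z hz e'
      have := (hpar z hz).1
      rw [e'] at this
      rcases (h z).1 this.symm with rfl | h0
      · exact absurd ha hz
      · exact h0
    refine ⟨fun z hz => ?_, fun h0 => absurd (e ▸ ha) h0,
      fun h0 => absurd (e ▸ ha) h0, fun z z' hz hz' e1 e2 => ?_⟩
    · rcases (h z).1 hz with rfl | rfl
      · exact Or.inl e.symm
      · exact Or.inr ⟨hy, ey⟩
    · rw [hch z hz e1, hch z' hz' e2]
  · have e := huniq x y hx ((h y).2 rfl) (Or.inr h)
    have ey := huniq y a hy ((h' a).2 (Or.inl rfl)) (Or.inl ha)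
    have hno : ∀ z, ¬ G.OnCycle z → par z ≠ x := by
      intro z hz e'
      have h1 := (hpar z hz).1
      rw [e'] at h1
      have h2 := (h z).1 h1.symm
      rw [h2, ey] at e'
      exact hx (e' ▸ ha)
    exact ⟨fun z hz => Or.inl (((h z).1 hz).trans e.symm), fun _ => by rw [e, ey]; exact ha,
      fun _ => hno, fun z z' hz _ hz' => absurd hz' (hno z hz)⟩

theorem IsUnicyclic.adj_eq_or_eq (hG : G.IsUnicyclic) (hpend : G.OnlyPendentPathsOnCycle 2)
    {x a b z : V} (hx : G.OnCycle x) (ha : G.OnCycle a) (hb : G.OnCycle b) (hz : G.OnCycle z)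
    (hxa : G.Adj x a) (hxb : G.Adj x b) (hab : a ≠ b) (hxz : G.Adj x z) : z = a ∨ z = b := by
  classical
  obtain ⟨par, hpar⟩ := hpend.exists_parent
  set GC := G.induce {x | G.OnCycle x} with hGC
  set C : Finset V := univ.filter fun x => G.OnCycle x with hC
  set O : Finset V := univ.filter fun x => ¬ G.OnCycle x with hO
  have hcardV : #C + #O = Fintype.card V := by
    rw [hC, hO, card_filter_add_card_filter_not, card_univ]
  have hcardC : Fintype.card {x | G.OnCycle x} = #C := by
    rw [hC, ← Set.toFinset_card]
    congr 1
    ext x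
    simp
  have hE : #G.edgeFinset = Fintype.card V := by
    rw [← hG.2, ← coe_edgeFinset, Set.ncard_coe_finset]
  have hEO : #(O.image fun x => s(x, par x)) = #O := by
    refine card_image_of_injOn fun x hx y hy h => ?_
    have hx' : ¬ G.OnCycle x := (mem_filter.1 hx).2
    have hy' : ¬ G.OnCycle y := (mem_filter.1 hy).2
    simp only [Sym2.eq_iff] at h
    rcases h with h | h
    · exact h.1
    · have := (hpar x hx').2.2.1 (h.2 ▸ hy')
      rw [h.2, ← h.1] at this
      exact absurd this hx'
  have hEC : #(GC.edgeFinset.image (Sym2.map Subtype.val)) = #GC.edgeFinset :=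
    card_image_of_injective _ (Sym2.map.injective Subtype.val_injective)
  have hdisj : Disjoint (GC.edgeFinset.image (Sym2.map Subtype.val))
      (O.image fun x => s(x, par x)) := by
    refine Finset.disjoint_left.2 ?_
    rintro e he he'
    obtain ⟨e, -, rfl⟩ := mem_image.1 he
    obtain ⟨x, hx, hxe⟩ := mem_image.1 he'
    have hx' : ¬ G.OnCycle x := (mem_filter.1 hx).2
    have : x ∈ Sym2.map Subtype.val e := hxe ▸ Sym2.mem_mk_left _ _
    obtain ⟨y, -, rfl⟩ := Sym2.mem_map.1 this
    exact hx' y.2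
  have hsub : GC.edgeFinset.image (Sym2.map Subtype.val) ∪ (O.image fun x => s(x, par x)) ⊆
      G.edgeFinset := by
    intro e he
    rcases mem_union.1 he with he' | he
    · obtain ⟨e', h, rfl⟩ := mem_image.1 he'
      clear he he'
      induction e' with
      | h x y =>
        have h' : G.Adj x y := mem_edgeFinset.1 h
        exact mem_edgeFinset.2 h'
    · obtain ⟨x, hx, rfl⟩ := mem_image.1 he
      rw [mem_edgeFinset]
      exact (hpar x (mem_filter.1 hx).2).1
  have hle : #GC.edgeFinset ≤ #C := by
    have := card_le_card hsub
    rw [card_union_of_disjoint hdisj, hEO, hEC, hE] at this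
    omega
  have hdeg2 : ∀ y : {x | G.OnCycle x}, 2 ≤ GC.degree y := by
    intro y
    obtain ⟨a, b, hab, ha, hb, ha', hb'⟩ := OnCycle.exists_two_adj y.2
    rw [← card_neighborFinset_eq_degree]
    have h1 : ({⟨a, ha'⟩, ⟨b, hb'⟩} : Finset {x | G.OnCycle x}) ⊆ GC.neighborFinset y := by
      intro z hz
      rw [mem_neighborFinset]
      rcases mem_insert.1 hz with rfl | hz
      · exact ha
      · rw [mem_singleton.1 hz]
        exact hb
    have h2 := card_le_card h1
    rwa [card_pair (by simpa using hab)] at h2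
  have hsum := GC.sum_degrees_eq_twice_card_edges
  have hall : ∀ y : {x | G.OnCycle x}, GC.degree y = 2 := by
    have h1 : ∑ _y : {x | G.OnCycle x}, 2 = ∑ y, GC.degree y := by
      refine le_antisymm (sum_le_sum fun y _ => hdeg2 y) ?_
      rw [hsum, sum_const, card_univ, hcardC, smul_eq_mul]
      omega
    intro y
    exact ((sum_eq_sum_iff_of_le fun y _ => hdeg2 y).1 h1 y (mem_univ y)).symm
  have := (adj_iff_of_degree_eq_two (G := GC) (x := ⟨x, hx⟩) (a := ⟨a, ha⟩) (b := ⟨b, hb⟩)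
    (by convert hall ⟨x, hx⟩) hxa hxb (by simpa using hab) ⟨z, hz⟩).1 hxz
  simpa using this

theorem IsUnicyclic.mem_support_of_onCycle (hG : G.IsUnicyclic)
    (hpend : G.OnlyPendentPathsOnCycle 2) {x : V} {p : G.Walk x x} (hp : p.IsCycle) {z : V}
    (hz : G.OnCycle z) : z ∈ p.support := by
  classical
  obtain ⟨par, hpar⟩ := hpend.exists_parent
  set root : V → V := fun z =>
    if G.OnCycle z then z else if G.OnCycle (par z) then par z else par (par z) with hroot
  have hpr : ∀ y, ¬ G.OnCycle y → root (par y) = root y := by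
    intro y hy
    by_cases h : G.OnCycle (par y)
    · simp [hroot, hy, h]
    · simp [hroot, hy, h, (hpar y hy).2.2.1 h]
  have hstep : ∀ y y', G.Adj y y' → root y ∈ p.support → root y' ∈ p.support := by
    intro y y' hadj hy
    by_cases h : G.OnCycle y
    · by_cases h' : G.OnCycle y'
      · have e : root y = y := if_pos h
        have e' : root y' = y' := if_pos h'
        rw [e] at hy
        rw [e']
        obtain ⟨a, b, hab, ha, hb, ha', hb'⟩ := hp.exists_two_adj hy
        rcases hG.adj_eq_or_eq hpend h (OnCycle.of_mem_support hp ha')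
          (OnCycle.of_mem_support hp hb') h' ha hb hab hadj with rfl | rfl
        · exact ha'
        · exact hb'
      · rcases (hpar y' h').2.1 y hadj.symm with e | e
        · rwa [← hpr y' h', ← e]
        · exact absurd h e.1
    · rcases (hpar y h).2.1 y' hadj with e | e
      · rwa [e, hpr y h]
      · rwa [← hpr y' e.1, e.2]
  have hwalk : ∀ y (q : G.Walk x y), root y ∈ p.support := by
    intro y q
    have : ∀ a b (_ : G.Walk a b), root a ∈ p.support → root b ∈ p.support := by
      intro a b q
      induction q with
      | nil => exact id
      | cons h _ ih => exact fun ha => ih (hstep _ _ h ha)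
    refine this x y q ?_
    have : root x = x := if_pos ⟨p, hp⟩
    rw [this]
    exact p.start_mem_support
  obtain ⟨q⟩ := hG.1.preconnected x z
  have := hwalk z q
  rwa [show root z = z from if_pos hz] at this

open Classical in
theorem IsUnicyclic.length_eq (hG : G.IsUnicyclic) (hpend : G.OnlyPendentPathsOnCycle 2)
    {x : V} {p : G.Walk x x} (hp : p.IsCycle) :
    p.length = #(univ.filter fun z => G.OnCycle z) := by
  have h1 : (univ.filter fun z => G.OnCycle z) = p.support.tail.toFinset := by
    ext z
    simp only [mem_filter, mem_univ, true_and, List.mem_toFinset]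
    constructor
    · intro hz
      have := hG.mem_support_of_onCycle hpend hp hz
      rcases (Walk.mem_support_iff p).1 this with rfl | h
      · exact p.end_mem_tail_support hp.not_nil
      · exact h
    · intro hz
      exact OnCycle.of_mem_support hp (List.mem_of_mem_tail hz)
  rw [h1, List.toFinset_card_of_nodup hp.support_nodup, List.length_tail, Walk.length_support,
    Nat.add_sub_cancel]

theorem IsUnicyclic.girth_eq (hG : G.IsUnicyclic) (hpend : G.OnlyPendentPathsOnCycle 2)
    {x : V} {p : G.Walk x x} (hp : p.IsCycle) : G.girth = p.length := by
  have hac : ¬ G.IsAcyclic := fun h => h p hp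
  obtain ⟨y, q, hq, hlen⟩ := exists_girth_eq_length.2 hac
  rw [hlen, hG.length_eq hpend hp, hG.length_eq hpend hq]

theorem IsUnicyclic.exists_isCycleWithPaths (hG : G.IsUnicyclic) (hg : 5 ≤ G.girth)
    (hpend : G.OnlyPendentPathsOnCycle 2) {u v w : V} (hu : G.OnCycle u) (hv : G.OnCycle v)
    (hw : G.OnCycle w) (huv : G.Adj u v) (hvw : G.Adj v w) (huw : u ≠ w) :
    ∃ (par : V → V) (c : ℕ → V) (m : ℕ), IsCycleWithPaths par c m ∧ G.girth = m + 3 ∧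
      (∀ x y, G.Adj x y ↔ par x = y ∨ par y = x) ∧ c m = u ∧ c (m + 1) = v ∧ c (m + 2) = w := by
  obtain ⟨p, hp, hpw, hpu⟩ : ∃ p : G.Walk v v, p.IsCycle ∧ p.snd = w ∧ p.penultimate = u := by
    obtain ⟨p, hp⟩ := id hv
    have h1 : G.OnCycle p.snd := OnCycle.of_mem_support hp (Walk.getVert_mem_support _ _)
    have h2 : G.OnCycle p.penultimate := OnCycle.of_mem_support hp (Walk.getVert_mem_support _ _)
    have h3 := Walk.adj_snd hp.not_nil
    have h4 := (Walk.adj_penultimate hp.not_nil).symm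
    have h5 := hp.snd_ne_penultimate
    have ew := hG.adj_eq_or_eq hpend hv h1 h2 hw h3 h4 h5 hvw
    have eu := hG.adj_eq_or_eq hpend hv h1 h2 hu h3 h4 h5 huv.symm
    rcases ew with ew | ew <;> rcases eu with eu | eu
    · exact absurd (eu.trans ew.symm) huw
    · exact ⟨p, hp, ew.symm, eu.symm⟩
    · exact ⟨p.reverse, hp.reverse, by rw [Walk.snd_reverse, ew],
        by rw [Walk.penultimate_reverse, eu]⟩
    · exact absurd (eu.trans ew.symm) huw
  have hlen := hG.girth_eq hpend hp
  obtain ⟨m, hm⟩ : ∃ m, p.length = m + 3 := ⟨p.length - 3, by omega⟩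
  set c : ℕ → V := fun j => if j ≤ m + 1 then p.getVert (j + 2) else p.getVert (j - (m + 1))
    with hc
  have hinj : ∀ i < m + 3, ∀ j < m + 3, c i = c j → i = j := by
    intro i hi j hj h
    simp only [hc] at h
    split_ifs at h with h1 h2 h2
    · have := hp.getVert_injOn (by simp only [Set.mem_ofPred_eq]; omega)
        (by simp only [Set.mem_ofPred_eq]; omega) h
      omega
    · have := hp.getVert_injOn (by simp only [Set.mem_ofPred_eq]; omega)
        (by simp only [Set.mem_ofPred_eq]; omega) h
      omega
    · have := hp.getVert_injOn (by simp only [Set.mem_ofPred_eq]; omega)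
        (by simp only [Set.mem_ofPred_eq]; omega) h
      omega
    · omega
  have hcv : c (m + 1) = v := by
    simp only [hc, if_pos le_rfl]
    rw [show m + 1 + 2 = p.length by omega, Walk.getVert_length]
  have hcu : c m = u := by
    simp only [hc, if_pos (Nat.le_succ m)]
    rw [← hpu, Walk.penultimate, hm]
    rfl
  have hcw : c (m + 2) = w := by
    simp only [hc, if_neg (show ¬ m + 2 ≤ m + 1 by omega)]
    rw [← hpw, Walk.snd]
    congr 1
    omega
  have hwrap : c (m + 3) = c 0 := by
    simp only [hc, if_neg (show ¬ m + 3 ≤ m + 1 by omega), if_pos (Nat.zero_le (m + 1))]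
    congr 1
    omega
  have hadjc : ∀ i < m + 3, G.Adj (c i) (c (i + 1)) := by
    intro i hi
    rcases (by omega : i ≤ m ∨ i = m + 1 ∨ i = m + 2) with h | rfl | rfl
    · simp only [hc, if_pos (show i ≤ m + 1 by omega), if_pos (show i + 1 ≤ m + 1 by omega)]
      exact p.adj_getVert_succ (by omega)
    · rw [hcv, hcw]
      exact hvw
    · rw [hcw, hwrap, ← hpw]
      simp only [hc, if_pos (Nat.zero_le (m + 1))]
      exact p.adj_getVert_succ (by omega)
  have hoff : ∀ x, IsOff c (m + 3) x ↔ ¬ G.OnCycle x := by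
    intro x
    constructor
    · intro h hx
      obtain ⟨i, hi, hi'⟩ := Walk.mem_support_iff_exists_getVert.1
        (hG.mem_support_of_onCycle hpend hp hx)
      rcases (by omega : i = 0 ∨ i = 1 ∨ 2 ≤ i) with rfl | rfl | h2
      · rw [Walk.getVert_zero] at hi
        exact h (m + 1) (by omega) (hcv.trans hi)
      · exact h (m + 2) (by omega) (hcw.trans (hpw.symm.trans hi))
      · refine h (i - 2) (by omega) ?_
        simp only [hc, if_pos (show i - 2 ≤ m + 1 by omega)]
        rw [← hi]
        congr 1
        omega
    · intro hx i _ h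
      refine hx (h ▸ OnCycle.of_mem_support hp ?_)
      simp only [hc]
      split_ifs <;> exact Walk.getVert_mem_support _ _
  obtain ⟨par₀, hpar₀⟩ := hpend.exists_parent
  obtain ⟨par, hpc, hpo⟩ := exists_eq_on_cycle_and_off hinj (fun i => c (i + 1)) par₀
  have hcy : ∀ i < m + 3, G.OnCycle (c i) := by
    intro i hi
    by_contra h
    exact (hoff _).2 h i hi rfl
  have hcy' : ∀ i < m + 3, G.OnCycle (par (c i)) := by
    intro i hi
    rw [hpc i hi]
    rcases Nat.lt_or_ge (i + 1) (m + 3) with h | h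
    · exact hcy _ h
    · rw [show i + 1 = m + 3 by omega, hwrap]
      exact hcy _ (by omega)
  have hchild : ∀ x y, ¬ G.OnCycle x → par y = x → ¬ G.OnCycle y := by
    intro x y hx h
    rcases eq_or_isOff c (m + 3) y with ⟨i, hi, rfl⟩ | hy
    · exact absurd (h ▸ hcy' i hi) hx
    · exact (hoff y).1 hy
  have H : IsCycleWithPaths par c m := by
    refine ⟨hinj, hpc, hwrap, ?_, ?_, ?_⟩
    · intro x hx hx'
      rw [hoff, not_not, hpo _ hx', hpo x hx]
      rw [hpo x hx] at hx'
      exact (hpar₀ x ((hoff x).1 hx)).2.2.1 ((hoff _).1 hx')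
    · intro x hx hx' y hy
      have hy' := hchild x y ((hoff x).1 hx) hy
      rw [hpo x hx] at hx'
      rw [hpo y ((hoff y).2 hy')] at hy
      exact (hpar₀ x ((hoff x).1 hx)).2.2.2.1 ((hoff _).1 hx') y hy' hy
    · intro x hx y z hy hz
      have hy' := hchild x y ((hoff x).1 hx) hy
      have hz' := hchild x z ((hoff x).1 hx) hz
      rw [hpo y ((hoff y).2 hy')] at hy
      rw [hpo z ((hoff z).2 hz')] at hz
      exact (hpar₀ x ((hoff x).1 hx)).2.2.2.2 y z hy' hz' hy hz
  have hparadj : ∀ x, G.Adj x (par x) := by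
    intro x
    rcases eq_or_isOff c (m + 3) x with ⟨i, hi, rfl⟩ | hx
    · rw [hpc i hi]
      exact hadjc i hi
    · rw [hpo x hx]
      exact (hpar₀ x ((hoff x).1 hx)).1
  have hoffadj : ∀ x y, ¬ G.OnCycle x → G.Adj x y → par x = y ∨ par y = x := by
    intro x y hx hxy
    rw [hpo x ((hoff x).2 hx)]
    rcases (hpar₀ x hx).2.1 y hxy with h | h
    · exact Or.inl h.symm
    · rw [hpo y ((hoff y).2 h.1)]
      exact Or.inr h.2
  refine ⟨par, c, m, H, by omega, fun x y => ⟨fun hxy => ?_, ?_⟩, hcu, hcv, hcw⟩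
  · by_cases hx : G.OnCycle x
    · by_cases hy : G.OnCycle y
      · obtain ⟨i, hi, rfl⟩ : ∃ i < m + 3, x = c (i + 1) := by
          rcases eq_or_isOff c (m + 3) x with ⟨i, hi, rfl⟩ | h
          · rcases i with _ | i
            · exact ⟨m + 2, by omega, hwrap.symm⟩
            · exact ⟨i, by omega, rfl⟩
          · exact absurd hx ((hoff x).1 h)
        have e := hpc i hi
        have hp' : G.OnCycle (par (c (i + 1))) := by
          rcases eq_or_isOff c (m + 3) (c (i + 1)) with ⟨j, hj, h⟩ | h
          · rw [h]
            exact hcy' j hj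
          · exact absurd hx ((hoff _).1 h)
        rcases hG.adj_eq_or_eq hpend hx (hcy i hi) hp' hy (hadjc i hi).symm (hparadj _)
          (fun h => H.par_par_ne (c i) (by rw [e, ← h])) hxy with rfl | rfl
        · exact Or.inr e
        · exact Or.inl rfl
      · exact (hoffadj y x hy hxy.symm).symm
    · exact hoffadj x y hx hxy
  · rintro (rfl | rfl)
    · exact hparadj x
    · exact (hparadj y).symm

end Extract

end SimpleGraph

end Prelim

theorem theorem2p6 {V : Type*} [Fintype V] (G : SimpleGraph V)
    (hn : 6 ≤ Fintype.card V) (hG : G.IsUnicyclic) (hg : 5 ≤ G.girth)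
    (hpend : G.OnlyPendentPathsOnCycle 2)
    (u v w : V) (hu : G.OnCycle u) (hv : G.OnCycle v) (hw : G.OnCycle w)
    (huv : G.Adj u v) (hvw : G.Adj v w) (huw : u ≠ w)
    (i : ℕ) (hi : i ≤ Fintype.card V) :
    (G.moveBranches u v w).signlessLapCoeff i ≤ G.signlessLapCoeff i ∧
    (G.signlessLapCoeff i = (G.moveBranches u v w).signlessLapCoeff i ↔
      i = 0 ∨ i = 1 ∨ i = Fintype.card V ∨
        (Fintype.card V = 6 ∧ G.girth = 5 ∧ i = 5)) := by
  obtain ⟨par, c, m, H, hgirth, hadj, rfl, rfl, rfl⟩ :=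
    hG.exists_isCycleWithPaths hg hpend hu hv hw huv hvw huw
  have h := SimpleGraph.signlessLapCoeff_moveBranches_of_par H (by omega) hadj hn hi
  rwa [show G.girth = 5 ↔ m = 2 by omega]
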